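/- Let $\mathcal H=\mathbb Q\langle Y\rangle$ be the quasi-shuffle Hopf algebra on the alphabet $Y=\{z_k : k\in\mathbb Z\}$: as a vector space it has the words in $Y$ as a basis; its product is the commutative quasi-shuffle product determined by $\mathbf 1 * v=v*\mathbf 1=v$ and $z_mv*z_nw=z_m(v*z_nw)+z_n(z_mv*w)+z_{m+n}(v*w)$; its coproduct is deconcatenation $\Delta(w)=\sum_{uv=w}u\otimes v$; its counit is $1$ on the empty word and $0$ on all other words. A non-empty word $z_{k_1}\cdots z_{k_n}$ is called non-singular if $k_1\neq 1$, $k_1+k_2\notin\{2,1,0,-2,-4,\dots\}$ (when $n\ge 2$), and $k_1+\cdots+k_j\notin\mathbb Z_{\le j}$ for $3\le j\le n$. Let $N\subseteq\mathcal H$ be the linear span of the non-singular words and $\mathcal N$ the ideal of $(\mathcal H,*)$ generated by $N$; it is a Hopf ideal. For a commutative unital $\mathbb Q$-algebra $\mathcal A$ let the renormalisation group $T_{\mathcal A}$ be the group, under convolution, of all unital algebra morphisms $\mathcal H\to\mathcal A$ that vanish on $N$. Let $$\widetilde\pi_1=\log^{\star}\mathrm{Id}=\sum_{n\ge 1}\frac{(-1)^{n-1}}{n}(\mathrm{Id}-u\circ\varepsilon)^{\star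 n}$$ be the Eulerian idempotent of the quotient Hopf algebra $\mathcal H/\mathcal N$ (where $u$, $\varepsilon$ and $\star$ are its unit, counit and convolution product; the sum is finite on every element), and let $W=\widetilde\pi_1(\mathcal H/\mathcal N)$. **Theorem.** The renormalisation group is pro-unipotent: the group functor $\mathcal A\mapsto T_{\mathcal A}$ on commutative $\mathbb Q$-algebras is a cofiltered limit of unipotent algebraic groups over $\mathbb Q$ (closed subgroups of groups of upper unitriangular matrices). Moreover, for every commutative unital $\mathbb Q$-algebra $\mathcal A$, the map $\psi\mapsto\Phi(\psi)$, $\Phi(\psi)([x])=\psi(x)$, is a group isomorphism from $T_{\mathcal A}$ onto the group of $\mathcal A$-valued characters of $\mathcal H/\mathcal N$, and $\psi\mapsto\Phi(\psi)|_W$ is a bijection from $T_{\mathcal A}$ onto the space $\mathcal L(W,\mathcal A)$ of linear maps from $W$ to $\mathcal A$. -/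

import Mathlib

open scoped TensorProduct
open WithConv

universe u

namespace RenormMZV

/-- The vector space `ℚ⟨Y⟩` on words in the alphabet `Y = {z_k : k ∈ ℤ}`; the word
`z_{k₁} ⋯ z_{kₙ}` is the list `[k₁, …, kₙ]`. -/
def QuasiShuffle : Type := List ℤ →₀ ℚ

namespace QuasiShuffle

noncomputable instance : AddCommGroup QuasiShuffle := inferInstanceAs (AddCommGroup (List ℤ →₀ ℚ))
noncomputable instance : Module ℚ QuasiShuffle := inferInstanceAs (Module ℚ (List ℤ →₀ ℚ))

/-- The basis of words. -/
noncomputable def wordBasis : Module.Basis (List ℤ) ℚ QuasiShuffle :=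
  Module.Basis.ofRepr (LinearEquiv.refl ℚ (List ℤ →₀ ℚ))

/-- A word, as an element of `ℚ⟨Y⟩`. -/
noncomputable def word (w : List ℤ) : QuasiShuffle := wordBasis w

/-- Left concatenation `x ↦ z_a x` with a letter. -/
noncomputable def prepend (a : ℤ) : QuasiShuffle →ₗ[ℚ] QuasiShuffle :=
  wordBasis.constr ℚ fun w => word (a :: w)

/-- The quasi-shuffle product of two words:
`z_m v * z_n w = z_m (v * z_n w) + z_n (z_m v * w) + z_{m+n} (v * w)`. -/
noncomputable def wordMul : List ℤ → List ℤ → QuasiShuffle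
  | [], v => word v
  | m :: v, [] => word (m :: v)
  | m :: v, n :: w =>
      prepend m (wordMul v (n :: w)) + prepend n (wordMul (m :: v) w) +
        prepend (m + n) (wordMul v w)
  termination_by u v => u.length + v.length

/-- The bilinear extension of the quasi-shuffle product. -/
noncomputable def mulMap : QuasiShuffle →ₗ[ℚ] QuasiShuffle →ₗ[ℚ] QuasiShuffle :=
  wordBasis.constr ℚ fun u => wordBasis.constr ℚ fun v => wordMul u v

theorem word_induction {p : QuasiShuffle → Prop} (h0 : p 0)
    (hadd : ∀ x y, p x → p y → p (x + y)) (hsmul : ∀ (c : ℚ) x, p x → p (c • x))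
    (hw : ∀ w, p (word w)) (x : QuasiShuffle) : p x := by
  have hx : x ∈ Submodule.span ℚ (Set.range wordBasis) := by
    rw [wordBasis.span_eq]; trivial
  induction hx using Submodule.span_induction with
  | mem x h => obtain ⟨w, rfl⟩ := h; exact hw w
  | zero => exact h0
  | add x y _ _ hx hy => exact hadd x y hx hy
  | smul c x _ hx => exact hsmul c x hx

theorem hom_ext {M : Type*} [AddCommMonoid M] [Module ℚ M] {f g : QuasiShuffle →ₗ[ℚ] M}
    (h : ∀ w, f (word w) = g (word w)) : f = g := wordBasis.ext h

theorem prepend_word (a : ℤ) (w : List ℤ) : prepend a (word w) = word (a :: w) := by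
  simp [prepend, word]

theorem mulMap_word (u v : List ℤ) : mulMap (word u) (word v) = wordMul u v := by
  simp [mulMap, word]

theorem nil_mulMap (x : QuasiShuffle) : mulMap (word []) x = x := by
  have : mulMap (word []) = LinearMap.id := hom_ext fun w => by
    rw [mulMap_word, wordMul]; rfl
  rw [this]; rfl

theorem mulMap_nil (x : QuasiShuffle) : mulMap x (word []) = x := by
  have : mulMap.flip (word []) = LinearMap.id := hom_ext fun w => by
    rw [LinearMap.flip_apply, mulMap_word]
    cases w <;> rw [wordMul] <;> rfl
  exact LinearMap.congr_fun this x

theorem prepend_mulMap_prepend (a b : ℤ) (x y : QuasiShuffle) :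
    mulMap (prepend a x) (prepend b y) =
      prepend a (mulMap x (prepend b y)) + prepend b (mulMap (prepend a x) y) +
        prepend (a + b) (mulMap x y) := by
  induction x using word_induction with
  | h0 => simp
  | hadd x x' h h' => simp only [map_add, LinearMap.add_apply, h, h']; abel
  | hsmul c x h => simp only [map_smul, LinearMap.smul_apply, h, smul_add]
  | hw u =>
    induction y using word_induction with
    | h0 => simp
    | hadd x x' h h' => simp only [map_add, h, h']; abel
    | hsmul c x h => simp only [map_smul, h, smul_add]
    | hw v =>
      simp only [prepend_word, mulMap_word]
      rw [wordMul]

theorem mulMap_comm (x y : QuasiShuffle) : mulMap x y = mulMap y x := by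
  have key : ∀ u v : List ℤ, mulMap (word u) (word v) = mulMap (word v) (word u) := by
    intro u
    induction u with
    | nil => intro v; rw [nil_mulMap, mulMap_nil]
    | cons a u ihu =>
      intro v
      induction v with
      | nil => rw [nil_mulMap, mulMap_nil]
      | cons b v ihv =>
        rw [← prepend_word, ← prepend_word, prepend_mulMap_prepend, prepend_mulMap_prepend,
          prepend_word, prepend_word, ihu, ihu, ihv, add_comm a b]
        abel
  have : mulMap = mulMap.flip := hom_ext fun u => hom_ext fun v => key u v
  exact LinearMap.congr_fun (LinearMap.congr_fun this x) y

theorem mulMap_assoc (x y z : QuasiShuffle) :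
    mulMap (mulMap x y) z = mulMap x (mulMap y z) := by
  have step : ∀ (a b c : ℤ) (x y z : QuasiShuffle),
      mulMap (mulMap x (prepend b y)) (prepend c z) =
        mulMap x (mulMap (prepend b y) (prepend c z)) →
      mulMap (mulMap x (prepend b y)) z = mulMap x (mulMap (prepend b y) z) →
      mulMap (mulMap x y) (prepend c z) = mulMap x (mulMap y (prepend c z)) →
      mulMap (mulMap x y) z = mulMap x (mulMap y z) →
      mulMap (mulMap (prepend a x) y) (prepend c z) =
        mulMap (prepend a x) (mulMap y (prepend c z)) →
      mulMap (mulMap (prepend a x) y) z = mulMap (prepend a x) (mulMap y z) →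
      mulMap (mulMap (prepend a x) (prepend b y)) z =
        mulMap (prepend a x) (mulMap (prepend b y) z) →
      mulMap (mulMap (prepend a x) (prepend b y)) (prepend c z) =
        mulMap (prepend a x) (mulMap (prepend b y) (prepend c z)) := by
    intro a b c x y z h1 h2 h3 h4 h5 h6 h7
    have k1 := congrArg (prepend a) h1
    have k7 := congrArg (prepend c) h7
    simp only [prepend_mulMap_prepend, map_add, LinearMap.add_apply] at k1 k7 ⊢
    simp only [h2, h3, h4, h5, h6, add_assoc a b c]
    linear_combination (norm := abel) k1 + k7
  have key : ∀ u v w : List ℤ, mulMap (mulMap (word u) (word v)) (word w) =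
      mulMap (word u) (mulMap (word v) (word w)) := by
    intro u
    induction u with
    | nil => intro v w; rw [nil_mulMap, nil_mulMap]
    | cons a u ihu =>
      intro v
      induction v with
      | nil => intro w; rw [nil_mulMap, mulMap_nil]
      | cons b v ihv =>
        intro w
        induction w with
        | nil => rw [mulMap_nil, mulMap_nil]
        | cons c w ihw =>
          have := step a b c (word u) (word v) (word w)
          simp only [prepend_word] at this
          exact this (ihu _ _) (ihu _ _) (ihu _ _) (ihu _ _) (ihv _) (ihv _) ihw
  induction x using word_induction with
  | h0 => simp
  | hadd x x' h h' => simp only [map_add, LinearMap.add_apply, h, h']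
  | hsmul c x h => simp only [map_smul, LinearMap.smul_apply, h]
  | hw u =>
    induction y using word_induction with
    | h0 => simp
    | hadd x x' h h' => simp only [map_add, LinearMap.add_apply, h, h']
    | hsmul c x h => simp only [map_smul, LinearMap.smul_apply, h]
    | hw v =>
      induction z using word_induction with
      | h0 => simp
      | hadd x x' h h' => simp only [map_add, h, h']
      | hsmul c x h => simp only [map_smul, h]
      | hw w => exact key u v w

/-- The quasi-shuffle algebra; the unit is the empty word. -/
noncomputable instance : CommRing QuasiShuffle :=
  { (inferInstance : AddCommGroup QuasiShuffle) with
    mul := fun x y => mulMap x y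
    one := word []
    left_distrib := fun x y z => map_add (mulMap x) y z
    right_distrib := fun x y z => by
      change mulMap (x + y) z = mulMap x z + mulMap y z
      rw [map_add, LinearMap.add_apply]
    zero_mul := fun x => by
      change mulMap 0 x = 0
      rw [map_zero, LinearMap.zero_apply]
    mul_zero := fun x => map_zero (mulMap x)
    mul_assoc := mulMap_assoc
    one_mul := nil_mulMap
    mul_one := mulMap_nil
    mul_comm := mulMap_comm }

theorem mul_def (x y : QuasiShuffle) : x * y = mulMap x y := rfl

theorem one_def : (1 : QuasiShuffle) = word [] := rfl

noncomputable instance : Algebra ℚ QuasiShuffle :=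
  Algebra.ofModule
    (fun c x y => by simp only [mul_def, map_smul, LinearMap.smul_apply])
    (fun c x y => by simp only [mul_def, map_smul])

theorem prepend_mul_prepend (a b : ℤ) (x y : QuasiShuffle) :
    prepend a x * prepend b y =
      prepend a (x * prepend b y) + prepend b (prepend a x * y) + prepend (a + b) (x * y) :=
  prepend_mulMap_prepend a b x y

theorem prepend_induction {p : QuasiShuffle → Prop} (h0 : p 0)
    (hadd : ∀ x y, p x → p y → p (x + y)) (hsmul : ∀ (c : ℚ) x, p x → p (c • x))
    (h1 : p 1) (hp : ∀ a x, p x → p (prepend a x)) (x : QuasiShuffle) : p x := by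
  refine word_induction h0 hadd hsmul (fun w => ?_) x
  induction w with
  | nil => exact h1
  | cons a w ih => rw [← prepend_word]; exact hp a _ ih

/-- Deconcatenation `Δ(w) = ∑_{uv = w} u ⊗ v`. -/
noncomputable def comulMap : QuasiShuffle →ₗ[ℚ] QuasiShuffle ⊗[ℚ] QuasiShuffle :=
  wordBasis.constr ℚ fun w =>
    ∑ i ∈ Finset.range (w.length + 1), word (w.take i) ⊗ₜ[ℚ] word (w.drop i)

/-- The counit: `1` on the empty word, `0` on all other words. -/
noncomputable def counitMap : QuasiShuffle →ₗ[ℚ] ℚ :=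
  wordBasis.constr ℚ fun w => if w = [] then 1 else 0

theorem comulMap_word (w : List ℤ) : comulMap (word w) =
    ∑ i ∈ Finset.range (w.length + 1), word (w.take i) ⊗ₜ[ℚ] word (w.drop i) := by
  simp [comulMap, word]

theorem counitMap_word (w : List ℤ) : counitMap (word w) = if w = [] then 1 else 0 := by
  simp [counitMap, word]

theorem comulMap_one : comulMap 1 = 1 ⊗ₜ 1 := by
  simp [one_def, comulMap_word]

theorem counitMap_one : counitMap 1 = 1 := by
  simp [one_def, counitMap_word]

theorem counitMap_prepend (a : ℤ) (x : QuasiShuffle) : counitMap (prepend a x) = 0 := by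
  have : counitMap ∘ₗ prepend a = 0 := hom_ext fun w => by
    simp [prepend_word, counitMap_word]
  exact LinearMap.congr_fun this x

theorem comulMap_prepend (a : ℤ) (x : QuasiShuffle) : comulMap (prepend a x) =
    1 ⊗ₜ prepend a x + (prepend a).rTensor QuasiShuffle (comulMap x) := by
  have : comulMap ∘ₗ prepend a = TensorProduct.mk ℚ _ _ 1 ∘ₗ prepend a +
      (prepend a).rTensor QuasiShuffle ∘ₗ comulMap := hom_ext fun w => by
    simp only [LinearMap.comp_apply, LinearMap.add_apply, prepend_word, comulMap_word, map_sum,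
      LinearMap.rTensor_tmul, List.length_cons, Finset.sum_range_succ' _ (w.length + 1),
      List.take_succ_cons, List.drop_succ_cons, List.take_zero, List.drop_zero,
      TensorProduct.mk_apply, one_def]
    rw [add_comm]
  exact LinearMap.congr_fun this x

noncomputable instance : Coalgebra ℚ QuasiShuffle where
  comul := comulMap
  counit := counitMap
  coassoc := by
    refine LinearMap.ext fun x => ?_
    simp only [LinearMap.comp_apply, LinearEquiv.coe_coe]
    have aux1 : ∀ (a : ℤ) (S : QuasiShuffle ⊗[ℚ] QuasiShuffle) (q : QuasiShuffle),
        TensorProduct.assoc ℚ _ _ _ ((prepend a).rTensor QuasiShuffle S ⊗ₜ[ℚ] q) =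
          (prepend a).rTensor _ (TensorProduct.assoc ℚ _ _ _ (S ⊗ₜ[ℚ] q)) := by
      intro a S q
      induction S using TensorProduct.induction_on with
      | zero => simp
      | tmul p r => simp
      | add S T hS hT => simp only [map_add, TensorProduct.add_tmul, hS, hT]
    have aux2 : ∀ (a : ℤ) (T : QuasiShuffle ⊗[ℚ] QuasiShuffle),
        TensorProduct.assoc ℚ _ _ _ (comulMap.rTensor QuasiShuffle ((prepend a).rTensor _ T)) =
          1 ⊗ₜ (prepend a).rTensor QuasiShuffle T + (prepend a).rTensor _
            (TensorProduct.assoc ℚ _ _ _ (comulMap.rTensor QuasiShuffle T)) := by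
      intro a T
      induction T using TensorProduct.induction_on with
      | zero => simp
      | tmul p r =>
        simp only [LinearMap.rTensor_tmul, comulMap_prepend, TensorProduct.add_tmul, map_add,
          aux1, TensorProduct.assoc_tmul]
      | add S T hS hT => simp only [map_add, TensorProduct.tmul_add, hS, hT]; abel
    have aux3 : ∀ (a : ℤ) (T : QuasiShuffle ⊗[ℚ] QuasiShuffle),
        comulMap.lTensor QuasiShuffle ((prepend a).rTensor _ T) =
          (prepend a).rTensor _ (comulMap.lTensor QuasiShuffle T) := by
      intro a T
      rw [← LinearMap.comp_apply, ← LinearMap.comp_apply, LinearMap.lTensor_comp_rTensor,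
        LinearMap.rTensor_comp_lTensor]
    induction x using prepend_induction with
    | h0 => simp
    | hadd x y hx hy => simp only [map_add, hx, hy]
    | hsmul c x hx => simp only [map_smul, hx]
    | h1 => simp [comulMap_one]
    | hp a x hx =>
      simp only [comulMap_prepend, map_add, LinearMap.rTensor_tmul, LinearMap.lTensor_tmul,
        comulMap_one, TensorProduct.assoc_tmul, aux2, aux3, hx, TensorProduct.tmul_add, add_assoc]
  rTensor_counit_comp_comul := by
    refine LinearMap.ext fun x => ?_
    simp only [LinearMap.comp_apply]
    induction x using prepend_induction with
    | h0 => simp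
    | hadd x y hx hy => simp only [map_add, hx, hy]
    | hsmul c x hx => simp only [map_smul, hx]
    | h1 => simp [comulMap_one, counitMap_one]
    | hp a x hx =>
      have : counitMap ∘ₗ prepend a = 0 := LinearMap.ext (counitMap_prepend a)
      simp only [comulMap_prepend, map_add, LinearMap.rTensor_tmul, counitMap_one]
      rw [← LinearMap.comp_apply, ← LinearMap.rTensor_comp, this]
      simp
  lTensor_counit_comp_comul := by
    refine LinearMap.ext fun x => ?_
    simp only [LinearMap.comp_apply]
    induction x using prepend_induction with
    | h0 => simp
    | hadd x y hx hy => simp only [map_add, hx, hy]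
    | hsmul c x hx => simp only [map_smul, hx]
    | h1 => simp [comulMap_one, counitMap_one]
    | hp a x hx =>
      have aux3 : ∀ (T : QuasiShuffle ⊗[ℚ] QuasiShuffle),
        counitMap.lTensor QuasiShuffle ((prepend a).rTensor _ T) =
          (prepend a).rTensor _ (counitMap.lTensor QuasiShuffle T) := by
        intro T
        rw [← LinearMap.comp_apply, ← LinearMap.comp_apply, LinearMap.lTensor_comp_rTensor,
          LinearMap.rTensor_comp_lTensor]
      simp only [comulMap_prepend, map_add, LinearMap.lTensor_tmul, counitMap_prepend, aux3, hx]
      simp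

theorem comul_mul (x y : QuasiShuffle) : comulMap (x * y) = comulMap x * comulMap y := by
  have aux1 : ∀ (a : ℤ) (p : QuasiShuffle) (T : QuasiShuffle ⊗[ℚ] QuasiShuffle),
      (1 ⊗ₜ[ℚ] p) * (prepend a).rTensor QuasiShuffle T =
        (prepend a).rTensor QuasiShuffle ((1 ⊗ₜ[ℚ] p) * T) := by
    intro a p T
    induction T using TensorProduct.induction_on with
    | zero => simp
    | tmul q r => simp
    | add S T hS hT => simp only [map_add, mul_add, hS, hT]
  have aux2 : ∀ (a b : ℤ) (S T : QuasiShuffle ⊗[ℚ] QuasiShuffle),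
      (prepend a).rTensor QuasiShuffle S * (prepend b).rTensor QuasiShuffle T =
        (prepend a).rTensor QuasiShuffle (S * (prepend b).rTensor QuasiShuffle T) +
        (prepend b).rTensor QuasiShuffle ((prepend a).rTensor QuasiShuffle S * T) +
        (prepend (a + b)).rTensor QuasiShuffle (S * T) := by
    intro a b S T
    induction S using TensorProduct.induction_on with
    | zero => simp
    | add S S' hS hT => simp only [map_add, add_mul, hS, hT]; abel
    | tmul p q =>
      induction T using TensorProduct.induction_on with
      | zero => simp
      | add S S' hS hT => simp only [map_add, mul_add, hS, hT]; abel
      | tmul r s =>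
        simp only [LinearMap.rTensor_tmul, Algebra.TensorProduct.tmul_mul_tmul,
          prepend_mul_prepend, TensorProduct.add_tmul]
  have key : ∀ u v : List ℤ,
      comulMap (word u * word v) = comulMap (word u) * comulMap (word v) := by
    have one_mul' : ∀ v, comulMap (word [] * word v) = comulMap (word []) * comulMap (word v) := by
      intro v
      rw [← one_def, one_mul, comulMap_one, ← Algebra.TensorProduct.one_def, one_mul]
    intro u
    induction u with
    | nil => exact one_mul'
    | cons a u ihu =>
      intro v
      induction v with
      | nil => rw [mul_comm, one_mul', mul_comm]
      | cons b v ihv =>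
        have h1 := ihu (b :: v)
        have h2 := ihu v
        have h3 := ihv
        simp only [← prepend_word] at h1 h3 ⊢
        rw [prepend_mul_prepend]
        simp only [map_add, comulMap_prepend, h1, h2, h3, prepend_mul_prepend,
          TensorProduct.tmul_add, mul_add, add_mul, aux1, aux2,
          Algebra.TensorProduct.tmul_mul_tmul, one_mul]
        rw [mul_comm ((prepend a).rTensor QuasiShuffle _) (1 ⊗ₜ[ℚ] _), aux1,
          mul_comm (comulMap (word u)) (1 ⊗ₜ[ℚ] _)]
        abel
  induction x using word_induction with
  | h0 => simp
  | hadd x x' h h' => simp only [map_add, add_mul, h, h']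
  | hsmul c x h => simp only [map_smul, smul_mul_assoc, h]
  | hw u =>
    induction y using word_induction with
    | h0 => simp
    | hadd x x' h h' => simp only [map_add, mul_add, h, h']
    | hsmul c x h => simp only [map_smul, mul_smul_comm, h]
    | hw v => exact key u v

theorem counit_mul (x y : QuasiShuffle) : counitMap (x * y) = counitMap x * counitMap y := by
  induction x using prepend_induction with
  | h0 => simp
  | hadd x x' h h' => simp only [map_add, add_mul, h, h']
  | hsmul c x h => simp only [map_smul, smul_mul_assoc, h]
  | h1 => rw [one_mul, counitMap_one, one_mul]
  | hp a x ih =>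
    clear ih
    induction y using prepend_induction with
    | h0 => simp
    | hadd x x' h h' => simp only [map_add, mul_add, h, h']
    | hsmul c x h => simp only [map_smul, mul_smul_comm, h]
    | h1 => rw [mul_one, counitMap_one, mul_one]
    | hp b y _ => simp only [prepend_mul_prepend, map_add, counitMap_prepend]; simp

noncomputable instance : Bialgebra ℚ QuasiShuffle :=
  Bialgebra.mk' ℚ QuasiShuffle counitMap_one (counit_mul _ _) comulMap_one (comul_mul _ _)

theorem comul_word (w : List ℤ) : Coalgebra.comul (R := ℚ) (word w) =
    ∑ i ∈ Finset.range (w.length + 1), word (w.take i) ⊗ₜ[ℚ] word (w.drop i) :=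
  comulMap_word w

theorem counit_word (w : List ℤ) :
    Coalgebra.counit (R := ℚ) (word w) = if w = [] then 1 else 0 :=
  counitMap_word w

theorem conv_word {A : Type*} [Semiring A] [Algebra ℚ A]
    (f g : WithConv (QuasiShuffle →ₗ[ℚ] A)) (w : List ℤ) :
    (f * g) (word w) =
      ∑ i ∈ Finset.range (w.length + 1), f (word (w.take i)) * g (word (w.drop i)) := by
  simp [comul_word]

/-- The antipode on words, by the recursion `S(w) = -∑_{uv = w, u ≠ 1} u * S(v)`. -/
noncomputable def antipodeWord (w : List ℤ) : QuasiShuffle :=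
  if w = [] then 1 else
    -∑ i : Fin w.length, word (w.take (i + 1)) * antipodeWord (w.drop (i + 1))
  termination_by w.length
  decreasing_by
    have := i.2
    simp only [List.length_drop]; omega

/-- The left convolution inverse of the identity on words. -/
noncomputable def leftAntipodeWord (w : List ℤ) : QuasiShuffle :=
  if w = [] then 1 else
    -∑ i : Fin w.length, leftAntipodeWord (w.take i) * word (w.drop i)
  termination_by w.length
  decreasing_by
    have := i.2
    simp only [List.length_take]; omega

noncomputable def antipodeMap : QuasiShuffle →ₗ[ℚ] QuasiShuffle :=
  wordBasis.constr ℚ antipodeWord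

theorem antipodeMap_word (w : List ℤ) : antipodeMap (word w) = antipodeWord w := by
  simp [antipodeMap, word]

theorem id_mul_antipodeMap :
    toConv LinearMap.id * toConv antipodeMap = (1 : WithConv (QuasiShuffle →ₗ[ℚ] QuasiShuffle)) := by
  refine WithConv.ext (hom_ext fun w => ?_)
  change (_ * _ : WithConv (QuasiShuffle →ₗ[ℚ] QuasiShuffle)) (word w) =
    (1 : WithConv (QuasiShuffle →ₗ[ℚ] QuasiShuffle)) (word w)
  rw [conv_word, LinearMap.convOne_apply, counit_word]
  simp only [LinearMap.id_apply, antipodeMap_word]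
  rw [Finset.sum_range_succ', List.take_zero, List.drop_zero, antipodeWord, ← one_def, one_mul]
  split_ifs with h
  · subst h; simp
  · rw [Finset.sum_range]; simp

theorem leftAntipode_mul_id :
    toConv (wordBasis.constr ℚ leftAntipodeWord) * toConv LinearMap.id =
      (1 : WithConv (QuasiShuffle →ₗ[ℚ] QuasiShuffle)) := by
  refine WithConv.ext (hom_ext fun w => ?_)
  change (_ * _ : WithConv (QuasiShuffle →ₗ[ℚ] QuasiShuffle)) (word w) =
    (1 : WithConv (QuasiShuffle →ₗ[ℚ] QuasiShuffle)) (word w)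
  have hl : ∀ w, wordBasis.constr ℚ leftAntipodeWord (word w) = leftAntipodeWord w := by
    intro w; simp [word]
  rw [conv_word, LinearMap.convOne_apply, counit_word]
  simp only [LinearMap.id_apply, hl]
  rw [Finset.sum_range_succ, List.take_length, List.drop_length, leftAntipodeWord.eq_1 w,
    ← one_def, mul_one]
  split_ifs with h
  · subst h; simp
  · rw [Finset.sum_range]; simp

/-- The quasi-shuffle Hopf algebra `H`. -/
noncomputable instance : HopfAlgebra ℚ QuasiShuffle :=
  HopfAlgebra.ofConvInverse antipodeMap
    (left_inv_eq_right_inv leftAntipode_mul_id id_mul_antipodeMap ▸ leftAntipode_mul_id)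
    id_mul_antipodeMap

end QuasiShuffle

section Characters

variable {k B A A' : Type*} [CommRing k] [CommRing B] [HopfAlgebra k B]
  [CommRing A] [Algebra k A] [CommRing A'] [Algebra k A']

/-- The group of `A`-valued characters of a commutative Hopf algebra `B`, with the convolution
product and `φ⁻¹ = φ ∘ S`. -/
noncomputable instance characterGroup : Group (WithConv (B →ₐ[k] A)) where
  inv φ := toConv (φ.ofConv.comp (HopfAlgebra.antipodeAlgHom k B))
  inv_mul_cancel φ := by
    apply WithConv.ext
    apply AlgHom.toLinearMap_injective
    have h := LinearMap.algHom_comp_convMul_distrib φ.ofConv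
      (toConv (HopfAlgebra.antipode k (A := B))) (toConv LinearMap.id)
    rw [LinearMap.antipode_mul_id] at h
    have h1 : φ.ofConv.toLinearMap ∘ₗ (1 : WithConv (B →ₗ[k] B)).ofConv =
        (1 : WithConv (B →ₗ[k] A)).ofConv := LinearMap.ext fun x => by simp
    exact h.symm.trans h1

theorem character_inv_apply (φ : WithConv (B →ₐ[k] A)) (x : B) :
    φ⁻¹.ofConv x = φ.ofConv (HopfAlgebra.antipode k x) := rfl

/-- Functoriality of the character group in the target algebra. -/
noncomputable def characterMap (f : A →ₐ[k] A') :
    WithConv (B →ₐ[k] A) →* WithConv (B →ₐ[k] A') where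
  toFun φ := toConv (f.comp φ.ofConv)
  map_one' := WithConv.ext (AlgHom.ext fun x => by simp)
  map_mul' φ ψ := WithConv.ext (AlgHom.comp_convMul_distrib f φ ψ)

end Characters

section ProUnipotent

open CategoryTheory

variable {k : Type} [Field k]

/-- The group functor `A ↦ Char(B, A)` represented by a commutative Hopf algebra `B`, on
commutative `k`-algebras. -/
noncomputable def pointsFunctor (k B : Type) [Field k] [CommRing B] [HopfAlgebra k B] :
    CommAlgCat.{u} k ⥤ GrpCat.{u} where
  obj A := GrpCat.of (WithConv (B →ₐ[k] A))
  map f := GrpCat.ofHom (characterMap f.hom)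

/-- A group functor is a unipotent algebraic group if it is represented by a Hopf algebra `B`
and embeds as a closed subgroup in a group `U_n` of upper unitriangular matrices. The closed
embedding is given by an upper unitriangular matrix `x` over `B` whose entries generate the
algebra `B`, with `Δ(x i j) = ∑ l, x i l ⊗ x l j` and `ε(x i j) = δ_{ij}`. -/
def IsUnipotentAlgebraicGroup (G : CommAlgCat.{u} k ⥤ GrpCat.{u}) : Prop :=
  ∃ (B : Type) (_ : CommRing B) (_ : HopfAlgebra k B) (n : ℕ) (x : Matrix (Fin n) (Fin n) B),
    Nonempty (G ≅ pointsFunctor k B) ∧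
    (∀ i, x i i = 1) ∧ (∀ i j, j < i → x i j = 0) ∧
    (∀ i j, Coalgebra.comul (R := k) (x i j) = ∑ l, x i l ⊗ₜ[k] x l j) ∧
    (∀ i j, Coalgebra.counit (R := k) (x i j) = (1 : Matrix (Fin n) (Fin n) k) i j) ∧
    Algebra.adjoin k {b | ∃ i j, b = x i j} = ⊤

/-- A group functor is pro-unipotent if it is a cofiltered limit of unipotent algebraic groups.
(Limits of group functors are computed pointwise.) -/
def IsProUnipotent (G : CommAlgCat.{u} k ⥤ GrpCat.{u}) : Prop :=
  ∃ (J : Type) (_ : SmallCategory J) (_ : IsCofiltered J)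
    (F : J ⥤ CommAlgCat.{u} k ⥤ GrpCat.{u}) (π : (Functor.const J).obj G ⟶ F),
    (∀ j, IsUnipotentAlgebraicGroup (F.obj j)) ∧ Nonempty (Limits.IsLimit (Limits.Cone.mk G π))

end ProUnipotent

section EulerianIdempotent

variable (k B : Type*) [Field k] [CharZero k] [CommRing B] [Bialgebra k B]

/-- Every element of `B` is killed by all large convolution powers of `id - u ∘ ε`, so that the
series `log⋆ id` is a finite sum on every element. -/
class IsConvConilpotent : Prop where
  exists_pow_eq_zero : ∀ x : B, ∃ n : ℕ, ∀ m : ℕ, n ≤ m →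
    ((toConv LinearMap.id - 1 : WithConv (B →ₗ[k] B)) ^ m) x = 0

variable [IsConvConilpotent k B]

/-- The Eulerian idempotent `log⋆ id = ∑_{n ≥ 1} (-1)^(n-1) / n • (id - u ∘ ε)^{⋆ n}`. -/
noncomputable def eulerianIdempotent : B →ₗ[k] B :=
  have fin (x : B) : (Function.support fun n : ℕ => ((-1 : k) ^ n / (n + 1 : k)) •
      ((toConv LinearMap.id - 1 : WithConv (B →ₗ[k] B)) ^ (n + 1)) x).Finite := by
    obtain ⟨n, hn⟩ := IsConvConilpotent.exists_pow_eq_zero (k := k) x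
    refine (Set.finite_lt_nat n).subset fun m hm => ?_
    by_contra h
    exact hm (by simp only [hn (m + 1) (by simp at h; omega), smul_zero])
  { toFun := fun x => ∑ᶠ n : ℕ, ((-1 : k) ^ n / (n + 1 : k)) •
      ((toConv LinearMap.id - 1 : WithConv (B →ₗ[k] B)) ^ (n + 1)) x
    map_add' := fun x y => by
      rw [← finsum_add_distrib (fin x) (fin y)]
      exact finsum_congr fun n => by rw [map_add, smul_add]
    map_smul' := fun c x => by
      rw [RingHom.id_apply, smul_finsum' c (fin x)]
      exact finsum_congr fun n => by rw [map_smul, smul_comm] }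

end EulerianIdempotent

open QuasiShuffle

/-- Non-singular (non-empty) words `z_{k₁} ⋯ z_{kₙ}`: `k₁ ≠ 1`,
`k₁ + k₂ ∉ {2, 1, 0, -2, -4, …}` if `n ≥ 2`, and `k₁ + ⋯ + k_j` is not `≤ j` for `3 ≤ j ≤ n`. -/
def IsNonsingular (w : List ℤ) : Prop :=
  w ≠ [] ∧ (w.take 1).sum ≠ 1 ∧
  (2 ≤ w.length → (w.take 2).sum ∉ ({2, 1} ∪ {m : ℤ | m ≤ 0 ∧ Even m} : Set ℤ)) ∧
  ∀ j : ℕ, 3 ≤ j → j ≤ w.length → ¬ (w.take j).sum ≤ (j : ℤ)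

theorem IsNonsingular.take {w : List ℤ} (hw : IsNonsingular w) {i : ℕ} (hi : i ≠ 0) :
    IsNonsingular (w.take i) := by
  obtain ⟨h0, h1, h2, h3⟩ := hw
  refine ⟨by simp [h0, hi], ?_, ?_, ?_⟩
  · rwa [List.take_take, min_eq_left (by omega)]
  · intro h
    rw [List.length_take] at h
    rw [List.take_take, min_eq_left (by omega)]
    exact h2 (by omega)
  · intro j hj hj'
    rw [List.length_take] at hj'
    rw [List.take_take, min_eq_left (by omega)]
    exact h3 j hj (by omega)

/-- The subspace `N` of `H` spanned by the non-singular words. -/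
noncomputable def nonsingularSpan : Submodule ℚ QuasiShuffle :=
  Submodule.span ℚ (word '' {w | IsNonsingular w})

/-- The ideal `𝒩` of `H` generated by `N`. -/
noncomputable def nonsingularIdeal : Ideal QuasiShuffle :=
  Ideal.span (nonsingularSpan : Set QuasiShuffle)

theorem word_mem_nonsingularIdeal {w : List ℤ} (hw : IsNonsingular w) :
    word w ∈ nonsingularIdeal :=
  Ideal.subset_span (Submodule.subset_span ⟨w, hw, rfl⟩)

theorem nonsingularIdeal_le {I : Ideal QuasiShuffle}
    (h : ∀ w, IsNonsingular w → word w ∈ I) : nonsingularIdeal ≤ I := by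
  refine Ideal.span_le.2 fun x hx => ?_
  have : nonsingularSpan ≤ I.restrictScalars ℚ := by
    refine Submodule.span_le.2 ?_
    rintro _ ⟨w, hw, rfl⟩
    exact h w hw
  exact this hx

theorem antipode_word_mem {w : List ℤ} (hw : IsNonsingular w) :
    HopfAlgebra.antipode ℚ (word w) ∈ nonsingularIdeal := by
  change antipodeMap (word w) ∈ nonsingularIdeal
  rw [antipodeMap_word, antipodeWord, if_neg hw.1]
  refine neg_mem (Ideal.sum_mem _ fun i _ => Ideal.mul_mem_right _ _ ?_)
  exact word_mem_nonsingularIdeal (hw.take (Nat.succ_ne_zero _))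

/-- `𝒩` is a Hopf ideal, so that `H ⧸ 𝒩` is a Hopf algebra. -/
instance : nonsingularIdeal.IsHopfIdeal ℚ where
  counit_eq_zero := by
    have : nonsingularIdeal ≤ RingHom.ker (Bialgebra.counitAlgHom ℚ QuasiShuffle) :=
      nonsingularIdeal_le fun w hw => by
        rw [RingHom.mem_ker, Bialgebra.counitAlgHom_apply, counit_word, if_neg hw.1]
    exact this
  map_mkQ_comul_eq_zero := by
    have : nonsingularIdeal ≤ RingHom.ker ((Algebra.TensorProduct.map
        (Ideal.Quotient.mkₐ ℚ nonsingularIdeal) (Ideal.Quotient.mkₐ ℚ nonsingularIdeal)).comp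
          (Bialgebra.comulAlgHom ℚ QuasiShuffle)) :=
      nonsingularIdeal_le fun w hw => by
        rw [RingHom.mem_ker, AlgHom.comp_apply, Bialgebra.comulAlgHom_apply, comul_word, map_sum]
        refine Finset.sum_eq_zero fun i _ => ?_
        rw [Algebra.TensorProduct.map_tmul]
        by_cases hi : i = 0
        · subst hi
          rw [List.drop_zero, Ideal.Quotient.mkₐ_eq_mk,
            Ideal.Quotient.eq_zero_iff_mem.2 (word_mem_nonsingularIdeal hw), TensorProduct.tmul_zero]
        · rw [Ideal.Quotient.mkₐ_eq_mk,
            Ideal.Quotient.eq_zero_iff_mem.2 (word_mem_nonsingularIdeal (hw.take hi)),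
            TensorProduct.zero_tmul]
    exact this
  antipode_mem := by
    have : nonsingularIdeal ≤ nonsingularIdeal.comap (HopfAlgebra.antipodeAlgHom ℚ QuasiShuffle) :=
      nonsingularIdeal_le fun w hw => antipode_word_mem hw
    exact this

theorem QuasiShuffle.pow_word_eq_zero (w : List ℤ) (m : ℕ) (hm : w.length < m) :
    ((toConv LinearMap.id - 1 : WithConv (QuasiShuffle →ₗ[ℚ] QuasiShuffle)) ^ m) (word w) = 0 := by
  induction m generalizing w with
  | zero => omega
  | succ m ih =>
    rw [pow_succ', conv_word]
    refine Finset.sum_eq_zero fun i hi => ?_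
    by_cases h : i = 0
    · subst h
      rw [List.take_zero]
      have : (toConv LinearMap.id - 1 : WithConv (QuasiShuffle →ₗ[ℚ] QuasiShuffle)) (word []) = 0 := by
        change word [] - algebraMap ℚ QuasiShuffle (Coalgebra.counit (word [])) = 0
        rw [counit_word, if_pos rfl, map_one, one_def, sub_self]
      rw [this, zero_mul]
    · by_cases h' : w = []
      · subst h'; simp at hi; omega
      · rw [ih _ (by
          have := List.length_pos_of_ne_nil h'
          rw [List.length_drop]; omega), mul_zero]

instance : IsConvConilpotent ℚ QuasiShuffle where
  exists_pow_eq_zero x := by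
    induction x using word_induction with
    | h0 => exact ⟨0, fun m _ => map_zero _⟩
    | hadd x y hx hy =>
      obtain ⟨n, hn⟩ := hx
      obtain ⟨n', hn'⟩ := hy
      refine ⟨max n n', fun m hm => ?_⟩
      rw [map_add, hn m (by omega), hn' m (by omega), add_zero]
    | hsmul c x hx =>
      obtain ⟨n, hn⟩ := hx
      exact ⟨n, fun m hm => by rw [map_smul, hn m hm, smul_zero]⟩
    | hw w => exact ⟨w.length + 1, fun m hm => pow_word_eq_zero w m (by omega)⟩

theorem pow_mk (m : ℕ) (x : QuasiShuffle) :
    ((toConv LinearMap.id - 1 : WithConv ((QuasiShuffle ⧸ nonsingularIdeal) →ₗ[ℚ]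
      (QuasiShuffle ⧸ nonsingularIdeal))) ^ m) (Ideal.Quotient.mk nonsingularIdeal x) =
    Ideal.Quotient.mk nonsingularIdeal
      (((toConv LinearMap.id - 1 : WithConv (QuasiShuffle →ₗ[ℚ] QuasiShuffle)) ^ m) x) := by
  let pr := Bialgebra.Quotient.mkBialgHom (R := ℚ) nonsingularIdeal
  suffices h : ((toConv LinearMap.id - 1 : WithConv ((QuasiShuffle ⧸ nonsingularIdeal) →ₗ[ℚ]
      (QuasiShuffle ⧸ nonsingularIdeal))) ^ m).ofConv ∘ₗ pr.toCoalgHom.toLinearMap =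
      (pr : QuasiShuffle →ₐ[ℚ] _).toLinearMap ∘ₗ
        ((toConv LinearMap.id - 1 : WithConv (QuasiShuffle →ₗ[ℚ] QuasiShuffle)) ^ m).ofConv from
    LinearMap.congr_fun h x
  induction m with
  | zero => exact LinearMap.ext fun x => rfl
  | succ m ih =>
    rw [pow_succ, pow_succ, LinearMap.convMul_comp_coalgHom_distrib,
      LinearMap.algHom_comp_convMul_distrib, ih]
    rfl

instance : IsConvConilpotent ℚ (QuasiShuffle ⧸ nonsingularIdeal) where
  exists_pow_eq_zero x := by
    obtain ⟨x, rfl⟩ := Ideal.Quotient.mk_surjective x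
    obtain ⟨n, hn⟩ := IsConvConilpotent.exists_pow_eq_zero (k := ℚ) x
    exact ⟨n, fun m hm => by rw [pow_mk, hn m hm, map_zero]⟩

theorem forall_nonsingularSpan_iff {A : Type*} [CommRing A] [Algebra ℚ A]
    {φ : QuasiShuffle →ₐ[ℚ] A} :
    (∀ x ∈ nonsingularSpan, φ x = 0) ↔ ∀ w, IsNonsingular w → φ (word w) = 0 := by
  refine ⟨fun h w hw => h _ (Submodule.subset_span ⟨w, hw, rfl⟩), fun h => ?_⟩
  have : nonsingularSpan ≤ LinearMap.ker φ.toLinearMap := by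
    refine Submodule.span_le.2 ?_
    rintro _ ⟨w, hw, rfl⟩
    exact h w hw
  exact this

/-- The renormalisation group `T_A`: the characters `H → A` that vanish on `N`. -/
noncomputable def renormalisationGroup (A : Type*) [CommRing A] [Algebra ℚ A] :
    Subgroup (WithConv (QuasiShuffle →ₐ[ℚ] A)) where
  carrier := {φ | ∀ x ∈ nonsingularSpan, φ.ofConv x = 0}
  mul_mem' {φ ψ} hφ hψ := by
    rw [Set.mem_ofPred_eq, forall_nonsingularSpan_iff] at hφ hψ ⊢
    intro w hw
    change (toConv φ.ofConv.toLinearMap * toConv ψ.ofConv.toLinearMap) (word w) = 0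
    rw [conv_word]
    refine Finset.sum_eq_zero fun i _ => ?_
    by_cases hi : i = 0
    · subst hi
      exact mul_eq_zero_of_right _ (hψ w hw)
    · exact mul_eq_zero_of_left (hφ _ (hw.take hi)) _
  one_mem' := by
    rw [Set.mem_ofPred_eq, forall_nonsingularSpan_iff]
    intro w hw
    change algebraMap ℚ A (Coalgebra.counit (word w)) = 0
    rw [counit_word, if_neg hw.1, map_zero]
  inv_mem' {φ} hφ := by
    rw [Set.mem_ofPred_eq, forall_nonsingularSpan_iff] at hφ ⊢
    intro w hw
    have h : nonsingularIdeal ≤ RingHom.ker φ.ofConv := nonsingularIdeal_le hφ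
    exact h (antipode_word_mem hw)

section RenormalisationFunctor

open CategoryTheory

/-- The renormalisation group as a group functor `A ↦ T_A`. -/
noncomputable def renormalisationFunctor : CommAlgCat.{u} ℚ ⥤ GrpCat.{u} where
  obj A := GrpCat.of (renormalisationGroup A)
  map f := GrpCat.ofHom (((characterMap f.hom).comp (Subgroup.subtype _)).codRestrict
    (renormalisationGroup _) fun φ x hx =>
      (congrArg f.hom (φ.2 x hx)).trans (map_zero f.hom))

end RenormalisationFunctor

/-- The image `W` of the Eulerian idempotent of the Hopf algebra `H ⧸ 𝒩`. -/
noncomputable def generatorSpace : Submodule ℚ (QuasiShuffle ⧸ nonsingularIdeal) :=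
  LinearMap.range (eulerianIdempotent ℚ (QuasiShuffle ⧸ nonsingularIdeal))

end RenormMZV

/-! Write C for the quotient of the word algebra by `nonsingularIdeal`. A character of the word
algebra that vanishes on the non-singular words kills the ideal they generate, so the
renormalisation group is the character group of the commutative Hopf algebra C, functorially in the
target (`renormalisationGroupEquiv`). Both claims are then statements about C.

The bijection with linear maps on W is a logarithm-exponential correspondence. Let π be the Eulerian
idempotent. At a fixed x, the convolution powers of the identity are polynomial in the exponent,
with linear coefficient π x (`exists_polynomial_id_pow`). Since C is commutative, these powers are
multiplicative, and comparing linear coefficients shows that π is a derivation with respect to the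
counit (`eulerianIdempotent_mul`). Hence for a linear map l on W the composite f = l ∘ π is an
infinitesimal character. Its exponential φ is a character (`IsInfinitesimal.convExp_mul`), and φ ∘ π
= log φ = f, so φ restricts to l on W. Conversely φ ∘ π is always log φ. On a non-empty word w, log
φ equals φ(w) plus terms involving only shorter words, so induction on length recovers φ from its
restriction to W (`character_ext_generatorSpace`).

For pro-unipotence, the contiguous factors of a word w, indexed by their start and end positions,
form an upper unitriangular matrix. Deconcatenation is exactly matrix comultiplication on it
(`comul_factorMatrix`). The factors of w thus generate a Hopf subalgebra representing a unipotent
group. These subalgebras are directed, since v and w are both factors of vw, and they cover C.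
Characters of a directed union are compatible families of characters, so the group functor of C is
the limit (`nonempty_isLimit_subalgebraCone`). -/

namespace RenormMZV

/-! ### Polynomial identities and binomial polynomials in characteristic zero. -/

section PolynomialIdentity

/-- Polynomials over an algebra over a field of characteristic zero are determined by their values
at the natural numbers. -/
theorem polynomial_ext_natCast (k : Type*) {A : Type*} [Field k] [CharZero k] [CommRing A]
    [Algebra k A] {p q : Polynomial A}
    (h : ∀ n : ℕ, p.eval (n : A) = q.eval (n : A)) :
    p = q := by
  suffices H : ∀ r : Polynomial A, (∀ n : ℕ, r.eval (n : A) = 0) → r = 0 from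
    sub_eq_zero.1 (H _ fun n => by rw [Polynomial.eval_sub, h, sub_self])
  intro r hr
  ext i
  rw [Polynomial.coeff_zero, ← Module.forall_dual_apply_eq_zero_iff k]
  intro l
  -- `A` may have zero divisors, so infinitely many roots do not by themselves force `r = 0`.
  -- Applying a `k`-linear functional to the coefficients gives a polynomial over the field `k`,
  -- which still vanishes at every natural number because these are scalars from `k`.
  let s : Polynomial k := ∑ j ∈ r.support, Polynomial.monomial j (l (r.coeff j))
  have hs : s = 0 := by
    refine Polynomial.eq_zero_of_infinite_isRoot s ((Set.infinite_range_of_injective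
      (Nat.cast_injective (R := k))).mono ?_)
    rintro _ ⟨n, rfl⟩
    have h1 := congrArg l (hr n)
    rw [Polynomial.eval_eq_sum, Polynomial.sum, map_sum, map_zero] at h1
    change s.eval (n : k) = 0
    rw [Polynomial.eval_finsetSum, ← h1]
    refine Finset.sum_congr rfl fun j _ => ?_
    have : r.coeff j * (n : A) ^ j = ((n : k) ^ j) • r.coeff j := by
      rw [Algebra.smul_def, mul_comm]; simp
    rw [Polynomial.eval_monomial, this, map_smul, smul_eq_mul, mul_comm]
  have h2 := congrArg (Polynomial.coeff · i) hs
  simp only [s, Polynomial.finsetSum_coeff, Polynomial.coeff_monomial, Finset.sum_ite_eq',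
    Polynomial.coeff_zero] at h2
  by_cases hi : i ∈ r.support
  · rwa [if_pos hi] at h2
  · rw [Polynomial.notMem_support_iff.1 hi, map_zero]

variable {k : Type*} [Field k]

variable (k) in
/-- The binomial coefficient `X.choose n` as a polynomial in `X`. -/
noncomputable def binomialPolynomial (n : ℕ) : Polynomial k :=
  Polynomial.C (n.factorial : k)⁻¹ * descPochhammer k n

theorem eval_neg_one_descPochhammer (n : ℕ) :
    (descPochhammer k n).eval (-1) = (-1) ^ n * (n.factorial : k) := by
  induction n with
  | zero => simp
  | succ n ih =>
    rw [descPochhammer_succ_eval, ih, Nat.factorial_succ]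
    push_cast; ring

theorem coeff_one_binomialPolynomial_zero : (binomialPolynomial k 0).coeff 1 = 0 := by
  simp [binomialPolynomial, Polynomial.coeff_one]

variable [CharZero k]

theorem eval_natCast_binomialPolynomial (n m : ℕ) :
    (binomialPolynomial k n).eval (m : k) = (m.choose n : k) := by
  rw [binomialPolynomial, Polynomial.eval_mul, Polynomial.eval_C,
    descPochhammer_eval_eq_descFactorial, Nat.descFactorial_eq_factorial_mul_choose, Nat.cast_mul,
    inv_mul_cancel_left₀ (by exact_mod_cast n.factorial_ne_zero)]

/-- The falling factorial of degree n + 1 is X times that of degree n shifted by one, so its linear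
coefficient is the latter's value at -1. These are the coefficients of log(1 + t), which is why
linear coefficients of convolution powers produce the Eulerian idempotent. -/
theorem coeff_one_binomialPolynomial_succ (n : ℕ) :
    (binomialPolynomial k (n + 1)).coeff 1 = (-1) ^ n / (n + 1 : k) := by
  have h1 : (n.factorial : k) ≠ 0 := by exact_mod_cast n.factorial_ne_zero
  have h2 : (n + 1 : k) ≠ 0 := by exact_mod_cast n.succ_ne_zero
  rw [binomialPolynomial, Polynomial.coeff_C_mul, descPochhammer_succ_left, Polynomial.coeff_X_mul,
    Polynomial.coeff_zero_eq_eval_zero, Polynomial.eval_comp]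
  simp only [Polynomial.eval_sub, Polynomial.eval_X, Polynomial.eval_one, zero_sub,
    eval_neg_one_descPochhammer, Nat.factorial_succ]
  push_cast
  field_simp

end PolynomialIdentity

/-! ### Power series in a locally nilpotent map, and polynomiality of convolution powers. -/

section ConvolutionPowerSeries

theorem conv_sum_apply {k B A ι : Type*} [Semiring k] [AddCommMonoid B] [Module k B] [AddCommMonoid A]
    [Module k A] (s : Finset ι) (g : ι → WithConv (B →ₗ[k] A)) (x : B) :
    (∑ i ∈ s, g i) x = ∑ i ∈ s, g i x := by
  change (∑ i ∈ s, g i).ofConv x = _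
  rw [WithConv.ofConv_sum, LinearMap.sum_apply]

variable {k B A : Type*} [Field k] [AddCommGroup B] [Module k B] [Coalgebra k B]
  [CommRing A] [Algebra k A]

/-- `f` is locally nilpotent for the convolution product. -/
def IsLocallyConvNilpotent (f : WithConv (B →ₗ[k] A)) : Prop :=
  ∀ x : B, ∃ n : ℕ, ∀ m : ℕ, n ≤ m → (f ^ m) x = 0

variable {f : WithConv (B →ₗ[k] A)}

theorem IsLocallyConvNilpotent.finite_support (hf : IsLocallyConvNilpotent f) (c : ℕ → k)
    (x : B) : (Function.support fun n => c n • (f ^ n) x).Finite := by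
  obtain ⟨N, hN⟩ := hf x
  refine (Set.finite_lt_nat N).subset fun m hm => ?_
  by_contra h
  exact hm (by simp only [hN m (not_lt.1 h), smul_zero])

/-- The value of a formal power series at a locally nilpotent map. -/
noncomputable def convEval (hf : IsLocallyConvNilpotent f) (p : PowerSeries k) :
    WithConv (B →ₗ[k] A) :=
  toConv
  { toFun := fun x => ∑ᶠ n : ℕ, PowerSeries.coeff n p • (f ^ n) x
    map_add' := fun x y => by
      rw [← finsum_add_distrib (hf.finite_support _ x) (hf.finite_support _ y)]
      exact finsum_congr fun n => by rw [map_add, smul_add]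
    map_smul' := fun c x => by
      rw [RingHom.id_apply, smul_finsum' c (hf.finite_support _ x)]
      exact finsum_congr fun n => by rw [map_smul, smul_comm] }

theorem finsum_eq_sum_range_of_le {M : Type*} [AddCommMonoid M] {g : ℕ → M} {N : ℕ}
    (h : ∀ m, N ≤ m → g m = 0) : ∑ᶠ n, g n = ∑ n ∈ Finset.range N, g n :=
  finsum_eq_sum_of_support_subset _ fun m hm => by
    by_contra h'
    exact hm (h m (by simpa using h'))

theorem convEval_apply (hf : IsLocallyConvNilpotent f) (p : PowerSeries k) (x : B) {N : ℕ}
    (hN : ∀ m, N ≤ m → (f ^ m) x = 0) :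
    convEval hf p x = ∑ n ∈ Finset.range N, PowerSeries.coeff n p • (f ^ n) x :=
  finsum_eq_sum_range_of_le fun m hm => by rw [hN m hm, smul_zero]

theorem convEval_one (hf : IsLocallyConvNilpotent f) : convEval hf 1 = 1 := by
  refine WithConv.ext (LinearMap.ext fun x => ?_)
  change ∑ᶠ n : ℕ, PowerSeries.coeff n (1 : PowerSeries k) • (f ^ n) x = (f ^ 0) x
  rw [finsum_eq_single _ 0 fun n hn => by rw [PowerSeries.coeff_one, if_neg hn, zero_smul]]
  simp

theorem conv_apply_repr {x : B} {ι : Type*} (r : Coalgebra.Repr k x ι)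
    (g h : WithConv (B →ₗ[k] A)) : (g * h) x = ∑ i ∈ r.index, g (r.left i) * h (r.right i) :=
  r.convMul_apply g h

theorem convEval_mul (hf : IsLocallyConvNilpotent f) (p q : PowerSeries k) :
    convEval hf (p * q) = convEval hf p * convEval hf q := by
  refine WithConv.ext (LinearMap.ext fun x => ?_)
  change convEval hf (p * q) x = (convEval hf p * convEval hf q) x
  let r := Coalgebra.Repr.arbitrary k x
  -- One truncation order serves `x` and all the finitely many tensor factors in a chosen expression
  -- of its coproduct, so every series involved becomes a finite sum.
  obtain ⟨N, hN, hl, hr⟩ : ∃ N, (∀ m, N ≤ m → (f ^ m) x = 0) ∧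
      (∀ i ∈ r.index, ∀ m, N ≤ m → (f ^ m) (r.left i) = 0) ∧
      (∀ i ∈ r.index, ∀ m, N ≤ m → (f ^ m) (r.right i) = 0) := by
    choose n hn using hf
    refine ⟨n x + (∑ i ∈ r.index, n (r.left i) + ∑ i ∈ r.index, n (r.right i)),
      fun m hm => hn _ _ (by omega), fun i hi m hm => hn _ _ ?_, fun i hi m hm => hn _ _ ?_⟩
    · have := Finset.single_le_sum (f := fun i => n (r.left i)) (fun _ _ => Nat.zero_le _) hi
      omega
    · have := Finset.single_le_sum (f := fun i => n (r.right i)) (fun _ _ => Nat.zero_le _) hi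
      omega
  have key : (convEval hf p * convEval hf q) x = ∑ a ∈ Finset.range N, ∑ b ∈ Finset.range N,
      (PowerSeries.coeff a p * PowerSeries.coeff b q) • (f ^ (a + b)) x := by
    simp only [pow_add, conv_apply_repr r, Finset.smul_sum]
    have : ∀ i ∈ r.index, convEval hf p (r.left i) * convEval hf q (r.right i) =
        ∑ a ∈ Finset.range N, ∑ b ∈ Finset.range N,
          (PowerSeries.coeff a p * PowerSeries.coeff b q) •
            ((f ^ a) (r.left i) * (f ^ b) (r.right i)) := fun i hi => by
      rw [convEval_apply hf p _ (hl i hi), convEval_apply hf q _ (hr i hi), Finset.sum_mul_sum]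
      refine Finset.sum_congr rfl fun a _ => Finset.sum_congr rfl fun b _ => ?_
      rw [smul_mul_smul_comm]
    rw [Finset.sum_congr rfl this, Finset.sum_comm]
    exact Finset.sum_congr rfl fun a _ => Finset.sum_comm
  have hN' : ∀ m, N + N ≤ m → (f ^ m) x = 0 := fun m hm => hN m (by omega)
  rw [key, convEval_apply hf _ x hN']
  simp only [PowerSeries.coeff_mul, Finset.sum_smul]
  rw [Finset.sum_sigma', ← Finset.sum_product']
  symm
  -- One sum runs over the square a, b < N, the other over antidiagonals n < 2N. Terms with a + b ≥
  -- N vanish, so the nonzero terms on both sides are indexed by the pairs with a + b < N.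
  refine Finset.sum_bij_ne_zero (fun ab _ _ => ⟨ab.1 + ab.2, ab⟩) ?_ ?_ ?_ ?_
  · rintro ⟨a, b⟩ h _
    simp at h ⊢; omega
  · rintro ⟨a, b⟩ _ _ ⟨c, d⟩ _ _ h
    simp at h ⊢; omega
  · rintro ⟨n, a, b⟩ h h0
    obtain rfl : a + b = n := Finset.HasAntidiagonal.mem_antidiagonal.1 (Finset.mem_sigma.1 h).2
    have hlt : a + b < N := by
      by_contra hh
      exact h0 (by simp only [hN _ (not_lt.1 hh), smul_zero])
    exact ⟨(a, b), by simp; omega, h0, rfl⟩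
  · rintro ⟨a, b⟩ _ _
    rfl

theorem convEval_pow (hf : IsLocallyConvNilpotent f) (p : PowerSeries k) (n : ℕ) :
    convEval hf (p ^ n) = convEval hf p ^ n := by
  induction n with
  | zero => rw [pow_zero, pow_zero, convEval_one]
  | succ n ih => rw [pow_succ, pow_succ, convEval_mul, ih]

variable [CharZero k]

/-- The values at `x` of the powers of `1 + f` depend polynomially on the exponent, with linear
coefficient `log (1 + f) x`. -/
theorem exists_polynomial_one_add_pow (hf : IsLocallyConvNilpotent f) (x : B) :
    ∃ P : Polynomial A, (∀ m : ℕ, P.eval (m : A) = ((1 + f) ^ m) x) ∧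
      P.coeff 1 = ∑ᶠ n : ℕ, ((-1 : k) ^ n / (n + 1 : k)) • (f ^ (n + 1)) x := by
  obtain ⟨N, hN⟩ := hf x
  -- This is the binomial series ∑ (X choose n) fⁿ(x). The extra index N makes the sum split as the
  -- constant term plus N terms, matching the logarithm, which starts at f¹.
  refine ⟨∑ n ∈ Finset.range (N + 1),
    Polynomial.C ((f ^ n) x) * (binomialPolynomial k n).map (algebraMap k A), fun m => ?_, ?_⟩
  · have e : ∀ n, (Polynomial.C ((f ^ n) x) *
        (binomialPolynomial k n).map (algebraMap k A)).eval (m : A) =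
        (m.choose n) • (f ^ n) x := fun n => by
      rw [Polynomial.eval_mul, Polynomial.eval_C, ← map_natCast (algebraMap k A) m,
        Polynomial.eval_map_algebraMap, Polynomial.aeval_algebraMap_apply,
        Polynomial.coe_aeval_eq_eval, eval_natCast_binomialPolynomial, map_natCast, nsmul_eq_mul,
        mul_comm]
    have h1 : ((1 + f) ^ m) x = ∑ n ∈ Finset.range (m + 1), (m.choose n) • (f ^ n) x := by
      rw [add_comm, (Commute.one_right f).add_pow, conv_sum_apply]
      refine Finset.sum_congr rfl fun n _ => ?_
      rw [one_pow, mul_one, ← nsmul_eq_mul']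
      rfl
    rw [Polynomial.eval_finsetSum, h1, Finset.sum_congr rfl fun n _ => e n]
    -- The left sum is cut off by nilpotency and the right one by vanishing binomial coefficients;
    -- both agree with the sum up to any larger bound.
    have h2 : ∀ M, N + 1 ≤ M → m + 1 ≤ M →
        ∑ n ∈ Finset.range (N + 1), (m.choose n) • (f ^ n) x =
        ∑ n ∈ Finset.range (m + 1), (m.choose n) • (f ^ n) x := fun M h3 h4 => by
      rw [Finset.sum_subset (Finset.range_mono h3), Finset.sum_subset (Finset.range_mono h4)]
      · intro n _ hn
        rw [Nat.choose_eq_zero_of_lt (by simpa using hn), zero_smul]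
      · intro n _ hn
        rw [hN n (by simp at hn; omega), smul_zero]
    exact h2 (N + m + 1) (by omega) (by omega)
  · rw [finsum_eq_sum_range_of_le (N := N) fun m hm => by rw [hN _ (by omega), smul_zero],
      Polynomial.finsetSum_coeff, Finset.sum_range_succ']
    simp only [Polynomial.coeff_C_mul, Polynomial.coeff_map, coeff_one_binomialPolynomial_zero,
      coeff_one_binomialPolynomial_succ, map_zero, mul_zero, add_zero]
    refine Finset.sum_congr rfl fun n _ => ?_
    rw [Algebra.smul_def, mul_comm]

/-- The convolution exponential of a locally nilpotent map. -/
noncomputable def convExp (hf : IsLocallyConvNilpotent f) : WithConv (B →ₗ[k] A) :=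
  convEval hf (PowerSeries.exp k)

/-- The values at `x` of the powers of `exp f` depend polynomially on the exponent, the `n`-th
coefficient being `f ^ n / n!`. -/
theorem exists_polynomial_convExp_pow (hf : IsLocallyConvNilpotent f) (x : B) :
    ∃ P : Polynomial A, (∀ m : ℕ, P.eval (m : A) = (convExp hf ^ m) x) ∧
      ∀ n, P.coeff n = (n.factorial : k)⁻¹ • (f ^ n) x := by
  obtain ⟨N, hN⟩ := hf x
  refine ⟨∑ n ∈ Finset.range N, Polynomial.monomial n ((n.factorial : k)⁻¹ • (f ^ n) x),
    fun m => ?_, fun n => ?_⟩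
  -- The identity exp(f)^m = exp(m f) holds already for power series, and evaluation at `f` is
  -- multiplicative.
  · rw [convExp, ← convEval_pow, PowerSeries.exp_pow_eq_rescale_exp, convEval_apply hf _ x hN,
      Polynomial.eval_finsetSum]
    refine Finset.sum_congr rfl fun n _ => ?_
    rw [Polynomial.eval_monomial, PowerSeries.coeff_rescale, PowerSeries.coeff_exp, mul_smul]
    simp [Algebra.smul_def, mul_comm]
  · simp only [Polynomial.finsetSum_coeff, Polynomial.coeff_monomial, Finset.sum_ite_eq',
      Finset.mem_range]
    split_ifs with h
    · rfl
    · rw [hN n (not_lt.1 h), smul_zero]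

end ConvolutionPowerSeries

/-! ### Infinitesimal characters, their exponentials, and the Eulerian idempotent. -/

section Infinitesimal

variable {k B A : Type*} [Field k] [CommRing B] [Bialgebra k B] [CommRing A] [Algebra k A]

/-- The convolution power of a linear map, composed with the multiplication of `B`. -/
theorem convPow_comp_mul (f : WithConv (B →ₗ[k] A)) (n : ℕ) :
    toConv ((f ^ n).ofConv ∘ₗ LinearMap.mul' k B) =
      (toConv (f.ofConv ∘ₗ LinearMap.mul' k B)) ^ n := by
  induction n with
  | zero =>
    refine WithConv.ext (TensorProduct.ext' fun x y => ?_)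
    change algebraMap k A (Coalgebra.counit (x * y)) =
      algebraMap k A (Coalgebra.counit (R := k) (x ⊗ₜ[k] y))
    rw [Bialgebra.counit_mul, TensorProduct.counit_tmul, smul_eq_mul, mul_comm]
  | succ n ih =>
    rw [pow_succ, pow_succ, ← ih]
    exact WithConv.ext
      (LinearMap.convMul_comp_coalgHom_distrib (f ^ n) f (Bialgebra.mulCoalgHom k B))

/-- The external product `x ⊗ y ↦ f x * g y`. -/
noncomputable def convTensor (f g : WithConv (B →ₗ[k] A)) : WithConv (B ⊗[k] B →ₗ[k] A) :=
  toConv ((Algebra.TensorProduct.lmul' k (S := A)).toLinearMap ∘ₗ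
    TensorProduct.map f.ofConv g.ofConv)

theorem convTensor_tmul (f g : WithConv (B →ₗ[k] A)) (x y : B) :
    convTensor f g (x ⊗ₜ y) = f x * g y := by
  simp [convTensor]

/-- Multiplication of the commutative algebra `A` is an algebra map, so it carries the factorwise
convolution of tensor products of maps to a convolution of maps into `A`. -/
theorem convTensor_mul_convTensor (f g h j : WithConv (B →ₗ[k] A)) :
    convTensor f g * convTensor h j = convTensor (f * h) (g * j) := by
  have h1 := LinearMap.algHom_comp_convMul_distrib (Algebra.TensorProduct.lmul' k (S := A))
    (toConv (TensorProduct.map f.ofConv g.ofConv)) (toConv (TensorProduct.map h.ofConv j.ofConv))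
  rw [TensorProduct.map_convMul_map] at h1
  exact WithConv.ext h1.symm

theorem convTensor_one_one : convTensor (1 : WithConv (B →ₗ[k] A)) 1 = 1 := by
  refine WithConv.ext (TensorProduct.ext' fun x y => ?_)
  change convTensor (1 : WithConv (B →ₗ[k] A)) 1 (x ⊗ₜ y) =
    algebraMap k A (Coalgebra.counit (R := k) (x ⊗ₜ[k] y))
  rw [convTensor_tmul, TensorProduct.counit_tmul, smul_eq_mul, map_mul, mul_comm]
  rfl

theorem convTensor_pow (f g : WithConv (B →ₗ[k] A)) (n : ℕ) :
    convTensor f g ^ n = convTensor (f ^ n) (g ^ n) := by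
  induction n with
  | zero => simp only [pow_zero, convTensor_one_one]
  | succ n ih => rw [pow_succ, ih, convTensor_mul_convTensor, ← pow_succ, ← pow_succ]

/-- Infinitesimal characters: derivations with respect to the counit. -/
def IsInfinitesimal (f : WithConv (B →ₗ[k] A)) : Prop :=
  ∀ x y : B, f (x * y) =
    f x * algebraMap k A (Coalgebra.counit y) + algebraMap k A (Coalgebra.counit x) * f y

variable {f : WithConv (B →ₗ[k] A)}

theorem IsInfinitesimal.apply_one (hf : IsInfinitesimal f) : f 1 = 0 := by
  have h := hf 1 1
  rw [Bialgebra.counit_one, map_one (algebraMap k A), mul_one, mul_one, one_mul] at h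
  exact left_eq_add.1 h

/-- The Leibniz rule for convolution powers of infinitesimal characters. -/
theorem IsInfinitesimal.pow_mul (hf : IsInfinitesimal f) (n : ℕ) (x y : B) :
    (f ^ n) (x * y) =
      ∑ m ∈ Finset.range (n + 1), (n.choose m) • ((f ^ m) x * (f ^ (n - m)) y) := by
  -- Being infinitesimal means that pulling `f` back along multiplication gives f ⊗ 1 + 1 ⊗ f. The
  -- two summands commute, so the Leibniz rule is the binomial theorem in the convolution algebra of
  -- `B ⊗ B`.
  have h : toConv (f.ofConv ∘ₗ LinearMap.mul' k B) = convTensor f 1 + convTensor 1 f := by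
    refine WithConv.ext (TensorProduct.ext' fun x y => ?_)
    change f (x * y) = convTensor f 1 (x ⊗ₜ y) + convTensor 1 f (x ⊗ₜ y)
    rw [hf x y, convTensor_tmul, convTensor_tmul]
    rfl
  have hc : Commute (convTensor f 1) (convTensor 1 f) := by
    rw [Commute, SemiconjBy, convTensor_mul_convTensor, convTensor_mul_convTensor]
    simp only [mul_one, one_mul]
  have h1 := congrArg (fun g => g.ofConv (x ⊗ₜ[k] y)) (convPow_comp_mul f n)
  rw [h, hc.add_pow] at h1
  refine h1.trans ((conv_sum_apply _ _ _).trans (Finset.sum_congr rfl fun m _ => ?_))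
  rw [convTensor_pow, convTensor_pow, convTensor_mul_convTensor, one_pow, one_pow, mul_one, one_mul,
    ← nsmul_eq_mul']
  exact congrArg (fun a : A => n.choose m • a) (convTensor_tmul _ _ x y)

/-- Commutativity of `B` is essential: it makes algebra maps closed under convolution. -/
theorem id_pow_apply_mul (m : ℕ) (x y : B) :
    ((toConv LinearMap.id : WithConv (B →ₗ[k] B)) ^ m) (x * y) =
      ((toConv LinearMap.id : WithConv (B →ₗ[k] B)) ^ m) x *
        ((toConv LinearMap.id : WithConv (B →ₗ[k] B)) ^ m) y := by
  have h := AlgHom.toLinearMap_convPow (toConv (AlgHom.id k B)) m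
  have h' : ∀ z, ((toConv (AlgHom.id k B)) ^ m).ofConv z =
    ((toConv LinearMap.id : WithConv (B →ₗ[k] B)) ^ m) z :=
    fun z => congrArg (fun g => g.ofConv z) h
  rw [← h', ← h', ← h', map_mul]

theorem isLocallyConvNilpotent_id_sub_one [IsConvConilpotent k B] :
    IsLocallyConvNilpotent (toConv LinearMap.id - 1 : WithConv (B →ₗ[k] B)) :=
  IsConvConilpotent.exists_pow_eq_zero

variable [CharZero k]

/-- The exponential of an infinitesimal character is multiplicative. -/
theorem IsInfinitesimal.convExp_mul (hf : IsInfinitesimal f) (hn : IsLocallyConvNilpotent f)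
    (x y : B) : convExp hn (x * y) = convExp hn x * convExp hn y := by
  obtain ⟨P, hP, hP'⟩ := exists_polynomial_convExp_pow hn x
  obtain ⟨Q, hQ, hQ'⟩ := exists_polynomial_convExp_pow hn y
  obtain ⟨R, hR, hR'⟩ := exists_polynomial_convExp_pow hn (x * y)
  -- The coefficients are divided powers fⁿ/n!, for which the Leibniz rule becomes the Cauchy
  -- product. Evaluation at 1 then gives multiplicativity of the exponential.
  have h : R = P * Q := by
    ext n
    rw [Polynomial.coeff_mul, hR', hf.pow_mul, Finset.smul_sum,
      Finset.Nat.sum_antidiagonal_eq_sum_range_succ_mk]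
    refine Finset.sum_congr rfl fun m hm => ?_
    rw [hP', hQ', smul_mul_smul_comm, ← Nat.cast_smul_eq_nsmul k, smul_smul,
      Nat.cast_choose k (by simpa [Nat.lt_succ_iff] using hm)]
    congr 1
    have h1 : (n.factorial : k) ≠ 0 := by exact_mod_cast n.factorial_ne_zero
    field_simp
  have h1 := hP 1
  have h2 := hQ 1
  have h3 := hR 1
  rw [pow_one] at h1 h2 h3
  rw [← h1, ← h2, ← h3, h, Polynomial.eval_mul]

/-- Since 1 is group-like and f(1) = 0, all positive powers of f vanish at 1 and only the constant
term of the exponential survives. -/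
theorem IsInfinitesimal.convExp_one (hf : IsInfinitesimal f) (hn : IsLocallyConvNilpotent f) :
    convExp hn 1 = 1 := by
  have h0 : ∀ m, 1 ≤ m → (f ^ m) 1 = 0 := fun m hm => by
    obtain ⟨m, rfl⟩ := Nat.exists_eq_succ_of_ne_zero (by omega : m ≠ 0)
    rw [pow_succ, LinearMap.convMul_apply, Bialgebra.comul_one, Algebra.TensorProduct.one_def,
      TensorProduct.map_tmul, LinearMap.mul'_apply, hf.apply_one, mul_zero]
  rw [convExp, convEval_apply hn _ 1 h0, Finset.sum_range_one, pow_zero, LinearMap.convOne_apply,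
    Bialgebra.counit_one, map_one, PowerSeries.coeff_exp]
  simp

/-- The exponential of an infinitesimal character, as a character. -/
noncomputable def IsInfinitesimal.expCharacter (hf : IsInfinitesimal f)
    (hn : IsLocallyConvNilpotent f) : WithConv (B →ₐ[k] A) :=
  toConv (AlgHom.ofLinearMap (convExp hn).ofConv (hf.convExp_one hn) (hf.convExp_mul hn))

variable [IsConvConilpotent k B]

theorem exists_polynomial_id_pow (x : B) :
    ∃ P : Polynomial B, (∀ m : ℕ, P.eval (m : B) =
      ((toConv LinearMap.id : WithConv (B →ₗ[k] B)) ^ m) x) ∧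
      P.coeff 1 = eulerianIdempotent k B x := by
  obtain ⟨P, h, h'⟩ := exists_polynomial_one_add_pow (isLocallyConvNilpotent_id_sub_one (k := k)) x
  exact ⟨P, fun m => by rw [h, add_sub_cancel], h'⟩

/-- The Eulerian idempotent is a derivation with respect to the counit. -/
theorem eulerianIdempotent_mul (x y : B) : eulerianIdempotent k B (x * y) =
    eulerianIdempotent k B x * algebraMap k B (Coalgebra.counit y) +
      algebraMap k B (Coalgebra.counit x) * eulerianIdempotent k B y := by
  obtain ⟨P, hP, hP'⟩ := exists_polynomial_id_pow (k := k) x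
  obtain ⟨Q, hQ, hQ'⟩ := exists_polynomial_id_pow (k := k) y
  obtain ⟨R, hR, hR'⟩ := exists_polynomial_id_pow (k := k) (x * y)
  have h : R = P * Q := polynomial_ext_natCast k fun n => by
    rw [Polynomial.eval_mul, hP, hQ, hR, id_pow_apply_mul]
  have hP0 := hP 0
  have hQ0 := hQ 0
  -- The constant coefficient is the zeroth convolution power, i.e. the counit followed by the unit.
  -- The linear coefficient of P * Q is therefore the derivation formula.
  rw [Nat.cast_zero, ← Polynomial.coeff_zero_eq_eval_zero, pow_zero, LinearMap.convOne_apply]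
    at hP0 hQ0
  rw [← hR', h, Polynomial.mul_coeff_one, hP0, hQ0, hP', hQ']
  ring

/-- The exponential of an infinitesimal character `f`, composed with `log id`, is `f`. -/
theorem IsInfinitesimal.expCharacter_eulerianIdempotent (hf : IsInfinitesimal f)
    (hn : IsLocallyConvNilpotent f) (x : B) :
    (hf.expCharacter hn).ofConv (eulerianIdempotent k B x) = f x := by
  obtain ⟨P, hP, hP'⟩ := exists_polynomial_id_pow (k := k) x
  obtain ⟨Q, hQ, hQ'⟩ := exists_polynomial_convExp_pow hn x
  let φ := (hf.expCharacter hn).ofConv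
  -- As an algebra map, φ carries powers of the identity to powers of φ. Hence applying φ to the
  -- coefficients of `P` gives `Q`, whose linear coefficient is f(x).
  have hφ : ∀ m : ℕ, φ (((toConv LinearMap.id : WithConv (B →ₗ[k] B)) ^ m) x) =
      (convExp hn ^ m) x := fun m => by
    suffices h : φ.toLinearMap ∘ₗ ((toConv LinearMap.id : WithConv (B →ₗ[k] B)) ^ m).ofConv =
        (convExp hn ^ m).ofConv from LinearMap.congr_fun h x
    induction m with
    | zero => exact LinearMap.ext fun x => by simp [φ]
    | succ m ih => rw [pow_succ, pow_succ, LinearMap.algHom_comp_convMul_distrib, ih]; rfl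
  have h : P.map (φ : B →+* A) = Q := polynomial_ext_natCast k fun n => by
    rw [hQ, ← map_natCast (φ : B →+* A) n, Polynomial.eval_map_apply, hP]
    exact hφ n
  have h1 := congrArg (Polynomial.coeff · 1) h
  simp only [Polynomial.coeff_map, hP', hQ'] at h1
  simpa [φ] using h1

/-- Every linear map on the image of the Eulerian idempotent extends to a character. -/
theorem exists_character_eq_on_range_eulerianIdempotent
    (hA : ∀ f : WithConv (B →ₗ[k] A), f 1 = 0 → IsLocallyConvNilpotent f)
    (l : LinearMap.range (eulerianIdempotent k B) →ₗ[k] A) :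
    ∃ φ : WithConv (B →ₐ[k] A), ∀ w : LinearMap.range (eulerianIdempotent k B),
      φ.ofConv w = l w := by
  -- With f = l ∘ π, the relation φ ∘ π = f says directly that φ and l agree on the range of π;
  -- idempotence of π plays no role.
  let f : WithConv (B →ₗ[k] A) := toConv (l ∘ₗ (eulerianIdempotent k B).rangeRestrict)
  have hf : IsInfinitesimal f := fun x y => by
    have : (eulerianIdempotent k B).rangeRestrict (x * y) =
        Coalgebra.counit (R := k) y • (eulerianIdempotent k B).rangeRestrict x +
          Coalgebra.counit (R := k) x • (eulerianIdempotent k B).rangeRestrict y :=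
      Subtype.ext <| (eulerianIdempotent_mul x y).trans <| by
        simp [Algebra.smul_def, mul_comm]
    change l _ = l _ * _ + _ * l _
    rw [this, map_add, map_smul, map_smul, Algebra.smul_def, Algebra.smul_def, mul_comm]
  refine ⟨hf.expCharacter (hA f hf.apply_one), ?_⟩
  rintro ⟨_, x, rfl⟩
  exact hf.expCharacter_eulerianIdempotent _ x

end Infinitesimal

open QuasiShuffle

/-! ### Length induction on words: nilpotency and uniqueness of characters. -/

section Words

variable {A : Type*} [CommRing A] [Algebra ℚ A]

/-- Cutting a word into more pieces than it has letters leaves an empty piece, where `f` vanishes.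
-/
theorem QuasiShuffle.convPow_word_eq_zero {f : WithConv (QuasiShuffle →ₗ[ℚ] A)}
    (hf : f (word []) = 0) (w : List ℤ) (m : ℕ) (hm : w.length < m) : (f ^ m) (word w) = 0 := by
  induction m generalizing w with
  | zero => omega
  | succ m ih =>
    rw [pow_succ', conv_word]
    refine Finset.sum_eq_zero fun i hi => ?_
    by_cases h : i = 0
    · rw [h, List.take_zero, hf, zero_mul]
    · by_cases h' : w = []
      · rw [h', List.take_nil, hf, zero_mul]
      · have := List.length_pos_of_ne_nil h'
        rw [ih _ (by rw [List.length_drop]; omega), mul_zero]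

/-- Convolution powers on a word depend only on the values at words that are not longer. -/
theorem QuasiShuffle.convPow_word_congr {f g : WithConv (QuasiShuffle →ₗ[ℚ] A)} {n : ℕ}
    (h : ∀ v : List ℤ, v.length ≤ n → f (word v) = g (word v)) (m : ℕ) {w : List ℤ}
    (hw : w.length ≤ n) : (f ^ m) (word w) = (g ^ m) (word w) := by
  induction m generalizing w with
  | zero => simp only [pow_zero]
  | succ m ih =>
    rw [pow_succ', pow_succ', conv_word, conv_word]
    refine Finset.sum_congr rfl fun i _ => ?_
    rw [h _ (by rw [List.length_take]; omega), ih (by rw [List.length_drop]; omega)]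

/-- For maps that vanish at `1`, the convolution powers with exponent at least two depend only
on the values at strictly shorter words. -/
theorem QuasiShuffle.convPow_word_congr_of_lt {f g : WithConv (QuasiShuffle →ₗ[ℚ] A)}
    (hf : f (word []) = 0) (hg : g (word []) = 0) {w : List ℤ}
    (h : ∀ v : List ℤ, v.length < w.length → f (word v) = g (word v)) (m : ℕ) :
    (f ^ (m + 2)) (word w) = (g ^ (m + 2)) (word w) := by
  rw [pow_succ' f (m + 1), pow_succ' g (m + 1), conv_word, conv_word]
  refine Finset.sum_congr rfl fun i hi => ?_
  rw [Finset.mem_range] at hi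
  by_cases h0 : i = 0
  · rw [h0, List.take_zero, hf, hg, zero_mul, zero_mul]
  -- This cut leaves the empty word to the remaining power, whose exponent is at least one, so the
  -- term is zero. For every other cut both pieces are strictly shorter than `w`.
  by_cases h1 : i = w.length
  · rw [h1, List.drop_length, convPow_word_eq_zero hf _ _ (by simp),
      convPow_word_eq_zero hg _ _ (by simp), mul_zero, mul_zero]
  · rw [h _ (by rw [List.length_take]; omega),
      convPow_word_congr (n := w.length - i) (fun v hv => h v (by omega)) _
        (by rw [List.length_drop])]

/-- The pullback of `f` to words. -/
theorem convPow_comp_mk (f : WithConv ((QuasiShuffle ⧸ nonsingularIdeal) →ₗ[ℚ] A)) (m : ℕ)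
    (x : QuasiShuffle) : (f ^ m) (Ideal.Quotient.mk nonsingularIdeal x) =
      ((toConv (f.ofConv ∘ₗ (Ideal.Quotient.mkₐ ℚ nonsingularIdeal).toLinearMap) :
        WithConv (QuasiShuffle →ₗ[ℚ] A)) ^ m) x := by
  let pr := Bialgebra.Quotient.mkBialgHom (R := ℚ) nonsingularIdeal
  suffices h : (f ^ m).ofConv ∘ₗ pr.toCoalgHom.toLinearMap =
      (toConv (f.ofConv ∘ₗ pr.toCoalgHom.toLinearMap) ^ m).ofConv from LinearMap.congr_fun h x
  induction m with
  | zero => exact LinearMap.ext fun x => rfl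
  | succ m ih => rw [pow_succ, pow_succ, LinearMap.convMul_comp_coalgHom_distrib, ih]

/-- This supplies the convergence hypothesis of `exists_character_eq_on_range_eulerianIdempotent`
for arbitrary targets: the vanishing depends only on word length. -/
theorem isLocallyConvNilpotent_of_apply_one
    (f : WithConv ((QuasiShuffle ⧸ nonsingularIdeal) →ₗ[ℚ] A)) (hf : f 1 = 0) :
    IsLocallyConvNilpotent f := by
  intro x
  obtain ⟨x, rfl⟩ := Ideal.Quotient.mk_surjective x
  simp only [convPow_comp_mk]
  induction x using word_induction with
  | h0 => exact ⟨0, fun m _ => map_zero _⟩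
  | hadd x y hx hy =>
    obtain ⟨n, hn⟩ := hx
    obtain ⟨n', hn'⟩ := hy
    refine ⟨max n n', fun m hm => ?_⟩
    rw [map_add, hn m (by omega), hn' m (by omega), add_zero]
  | hsmul c x hx =>
    obtain ⟨n, hn⟩ := hx
    exact ⟨n, fun m hm => by rw [map_smul, hn m hm, smul_zero]⟩
  | hw w => exact ⟨w.length + 1, fun m hm => convPow_word_eq_zero hf w m (by omega)⟩

/-- A character composed with the Eulerian idempotent is the logarithm of the character. -/
theorem character_eulerianIdempotent {B : Type*} [CommRing B] [Bialgebra ℚ B]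
    [IsConvConilpotent ℚ B] (φ : B →ₐ[ℚ] A) (x : B) :
    φ (eulerianIdempotent ℚ B x) = ∑ᶠ n : ℕ, ((-1 : ℚ) ^ n / (n + 1 : ℚ)) •
      ((toConv φ.toLinearMap - 1 : WithConv (B →ₗ[ℚ] A)) ^ (n + 1)) x := by
  have hφ : ∀ m, φ.toLinearMap ∘ₗ ((toConv LinearMap.id - 1 : WithConv (B →ₗ[ℚ] B)) ^ m).ofConv =
      ((toConv φ.toLinearMap - 1 : WithConv (B →ₗ[ℚ] A)) ^ m).ofConv := fun m => by
    induction m with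
    | zero => exact LinearMap.ext fun x => by simp
    | succ m ih =>
      rw [pow_succ, pow_succ, LinearMap.algHom_comp_convMul_distrib, ih]
      congr 2
      exact WithConv.ext (LinearMap.ext fun x => by simp)
  obtain ⟨N, hN⟩ := IsConvConilpotent.exists_pow_eq_zero (k := ℚ) x
  have hN' : ∀ m, N ≤ m → ((toConv φ.toLinearMap - 1 : WithConv (B →ₗ[ℚ] A)) ^ m) x = 0 :=
    fun m hm => by
      rw [← hφ, LinearMap.comp_apply, hN m hm, map_zero]
  have h1 : eulerianIdempotent ℚ B x = ∑ n ∈ Finset.range N, ((-1 : ℚ) ^ n / (n + 1 : ℚ)) •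
      ((toConv LinearMap.id - 1 : WithConv (B →ₗ[ℚ] B)) ^ (n + 1)) x :=
    finsum_eq_sum_range_of_le fun m hm => by rw [hN _ (by omega), smul_zero]
  rw [h1, finsum_eq_sum_range_of_le (N := N) fun m hm => by rw [hN' _ (by omega), smul_zero],
    map_sum]
  refine Finset.sum_congr rfl fun n _ => ?_
  rw [map_smul]
  congr 1
  exact LinearMap.congr_fun (hφ (n + 1)) x

/-- A character of `H ⧸ 𝒩` is determined by its restriction to the image of the Eulerian
idempotent. -/
theorem character_ext_generatorSpace {φ ψ : (QuasiShuffle ⧸ nonsingularIdeal) →ₐ[ℚ] A}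
    (h : ∀ w ∈ generatorSpace, φ w = ψ w) : φ = ψ := by
  refine Ideal.Quotient.algHom_ext ℚ (AlgHom.toLinearMap_injective (hom_ext fun w => ?_))
  change φ (Ideal.Quotient.mk nonsingularIdeal (word w)) =
    ψ (Ideal.Quotient.mk nonsingularIdeal (word w))
  generalize hn : w.length = n
  induction n using Nat.strong_induction_on generalizing w with
  | _ n ih =>
    let f (χ : (QuasiShuffle ⧸ nonsingularIdeal) →ₐ[ℚ] A) :
        WithConv (QuasiShuffle →ₗ[ℚ] A) :=
      toConv ((toConv χ.toLinearMap - 1 :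
        WithConv ((QuasiShuffle ⧸ nonsingularIdeal) →ₗ[ℚ] A)).ofConv ∘ₗ
          (Ideal.Quotient.mkₐ ℚ nonsingularIdeal).toLinearMap)
    have f_word : ∀ χ v, f χ (word v) = χ (Ideal.Quotient.mk nonsingularIdeal (word v)) -
        algebraMap ℚ A (if v = [] then 1 else 0) := fun χ v => by
      rw [← counit_word]; rfl
    have f_nil : ∀ χ, f χ (word []) = 0 := fun χ => by
      rw [f_word, if_pos rfl, map_one, ← one_def, map_one, map_one, sub_self]
    have key := h _ (LinearMap.mem_range_self _ (Ideal.Quotient.mk nonsingularIdeal (word w)))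
    rw [character_eulerianIdempotent, character_eulerianIdempotent] at key
    simp only [convPow_comp_mk] at key
    -- The linear term of the logarithm is separated from the powers with exponent at least two. The
    -- latter agree for φ and ψ by the induction hypothesis, so equality of the logarithms forces
    -- equality at `w`.
    have e : ∀ χ, ∑ᶠ i : ℕ, ((-1 : ℚ) ^ i / (i + 1 : ℚ)) • (f χ ^ (i + 1)) (word w) =
        ∑ i ∈ Finset.range n, ((-1 : ℚ) ^ (i + 1) / ((i + 1 : ℕ) + 1 : ℚ)) •
          (f χ ^ (i + 2)) (word w) + f χ (word w) := fun χ => by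
      rw [finsum_eq_sum_range_of_le (N := n + 1) fun m hm => by
        rw [convPow_word_eq_zero (f_nil χ) _ _ (by omega), smul_zero], Finset.sum_range_succ']
      simp
    have key' := (e φ).symm.trans (key.trans (e ψ))
    have hlt : ∀ v : List ℤ, v.length < w.length → f φ (word v) = f ψ (word v) := fun v hv => by
      rw [f_word, f_word, ih _ (hn ▸ hv) v rfl]
    rw [Finset.sum_congr rfl fun i _ => by
      rw [convPow_word_congr_of_lt (f_nil φ) (f_nil ψ) hlt i], add_right_inj, f_word, f_word,
      sub_left_inj] at key'
    exact key'

end Words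

/-! ### The renormalisation group as the character group of the quotient. -/

section CharactersOfQuotient

theorem nonsingularIdeal_le_ker {A : Type*} [CommRing A] [Algebra ℚ A]
    (ψ : renormalisationGroup A) {x : QuasiShuffle} (hx : x ∈ nonsingularIdeal) :
    ψ.1.ofConv x = 0 :=
  nonsingularIdeal_le (I := RingHom.ker ψ.1.ofConv) (forall_nonsingularSpan_iff.1 ψ.2) hx

/-- The renormalisation group is the group of characters of `H ⧸ 𝒩`. -/
noncomputable def renormalisationGroupEquiv (A : Type*) [CommRing A] [Algebra ℚ A] :
    renormalisationGroup A ≃* WithConv ((QuasiShuffle ⧸ nonsingularIdeal) →ₐ[ℚ] A) :=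
  MulEquiv.symm
  { toFun := fun φ => ⟨toConv (φ.ofConv.comp (Ideal.Quotient.mkₐ ℚ nonsingularIdeal)),
      forall_nonsingularSpan_iff.2 fun w hw => by
        change φ.ofConv (Ideal.Quotient.mk nonsingularIdeal (word w)) = 0
        rw [Ideal.Quotient.eq_zero_iff_mem.2 (word_mem_nonsingularIdeal hw), map_zero]⟩
    invFun := fun ψ => toConv (Ideal.Quotient.liftₐ nonsingularIdeal ψ.1.ofConv
      fun _ hx => nonsingularIdeal_le_ker ψ hx)
    left_inv := fun φ => WithConv.ext (Ideal.Quotient.algHom_ext ℚ (AlgHom.ext fun x => rfl))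
    right_inv := fun ψ => Subtype.ext (WithConv.ext (AlgHom.ext fun x => rfl))
    map_mul' := fun φ ψ => Subtype.ext (WithConv.ext
      (AlgHom.convMul_comp_bialgHom_distrib φ ψ
        (Bialgebra.Quotient.mkBialgHom (R := ℚ) nonsingularIdeal))) }

theorem renormalisationGroupEquiv_mk {A : Type*} [CommRing A] [Algebra ℚ A]
    (ψ : renormalisationGroup A) (x : QuasiShuffle) :
    (renormalisationGroupEquiv A ψ).ofConv (Ideal.Quotient.mk nonsingularIdeal x) =
      ψ.1.ofConv x := rfl

theorem bijective_domRestrict_generatorSpace (A : Type*) [CommRing A] [Algebra ℚ A] :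
    Function.Bijective fun ψ : renormalisationGroup A =>
      ((renormalisationGroupEquiv A ψ).ofConv.toLinearMap.domRestrict generatorSpace :
        generatorSpace →ₗ[ℚ] A) := by
  constructor
  · intro φ ψ h
    refine (renormalisationGroupEquiv A).injective (WithConv.ext ?_)
    exact character_ext_generatorSpace fun w hw => LinearMap.congr_fun h ⟨w, hw⟩
  · intro l
    obtain ⟨φ, hφ⟩ :=
      exists_character_eq_on_range_eulerianIdempotent isLocallyConvNilpotent_of_apply_one l
    refine ⟨(renormalisationGroupEquiv A).symm φ, LinearMap.ext fun w => ?_⟩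
    exact (congrArg (fun χ : WithConv ((QuasiShuffle ⧸ nonsingularIdeal) →ₐ[ℚ] A) => χ.ofConv w)
      ((renormalisationGroupEquiv A).apply_symm_apply φ)).trans (hφ w)

end CharactersOfQuotient

/-! ### Hopf structures restricted to subalgebras. -/

section HopfSubalgebras

/-- A Hopf subalgebra: a subalgebra stable under the coproduct and the antipode. -/
structure HopfSubalgebra (k B : Type*) [Field k] [CommRing B] [HopfAlgebra k B] where
  toSubalgebra : Subalgebra k B
  comul_mem : ∀ x ∈ toSubalgebra, Bialgebra.comulAlgHom k B x ∈
    (Algebra.TensorProduct.map toSubalgebra.val toSubalgebra.val).range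
  antipode_mem : ∀ x ∈ toSubalgebra, HopfAlgebra.antipode k x ∈ toSubalgebra

namespace HopfSubalgebra

variable {k B : Type*} [Field k] [CommRing B] [HopfAlgebra k B]

instance : Preorder (HopfSubalgebra k B) := Preorder.lift toSubalgebra

/-- Over a field all modules are flat, so tensor powers of a subalgebra embed in those of `B`. The
coalgebra axioms for the subalgebra can then be checked inside `B`. -/
theorem map_val_injective (S : Subalgebra k B) :
    Function.Injective (Algebra.TensorProduct.map S.val S.val) :=
  TensorProduct.map_injective_of_flat_flat S.val.toLinearMap S.val.toLinearMap
    Subtype.val_injective Subtype.val_injective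

theorem map_map_val_injective (S : Subalgebra k B) : Function.Injective
    (Algebra.TensorProduct.map S.val (Algebra.TensorProduct.map S.val S.val)) :=
  TensorProduct.map_injective_of_flat_flat S.val.toLinearMap
    (Algebra.TensorProduct.map S.val S.val).toLinearMap
    Subtype.val_injective (map_val_injective S)

variable (S : HopfSubalgebra k B)

/-- The restricted coproduct. -/
noncomputable def comulHom :
    S.toSubalgebra →ₐ[k] S.toSubalgebra ⊗[k] S.toSubalgebra :=
  (AlgEquiv.ofInjective _ (map_val_injective S.toSubalgebra)).symm.toAlgHom.comp
    (((Bialgebra.comulAlgHom k B).comp S.toSubalgebra.val).codRestrict _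
      fun x => S.comul_mem x x.2)

theorem map_val_comulHom (x : S.toSubalgebra) :
    Algebra.TensorProduct.map S.toSubalgebra.val S.toSubalgebra.val (S.comulHom x) =
      Coalgebra.comul (R := k) (x : B) :=
  congrArg Subtype.val ((AlgEquiv.ofInjective _ (map_val_injective S.toSubalgebra)).apply_symm_apply
    ⟨Bialgebra.comulAlgHom k B x, S.comul_mem x x.2⟩)

noncomputable instance : Bialgebra k S.toSubalgebra := by
  let i := S.toSubalgebra.val
  refine Bialgebra.ofAlgHom S.comulHom ((Bialgebra.counitAlgHom k B).comp S.toSubalgebra.val)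
    ?_ ?_ ?_
  · refine AlgHom.ext fun x => map_map_val_injective S.toSubalgebra ?_
    have h1 : ∀ (t : S.toSubalgebra ⊗[k] S.toSubalgebra) (b : S.toSubalgebra),
        Algebra.TensorProduct.map i (Algebra.TensorProduct.map i i)
          (Algebra.TensorProduct.assoc k k k _ _ _ (t ⊗ₜ[k] b)) =
        Algebra.TensorProduct.assoc k k k _ _ _ (Algebra.TensorProduct.map i i t ⊗ₜ[k] (b : B)) := by
      intro t b
      induction t using TensorProduct.induction_on with
      | zero => simp
      | tmul p q => simp [i]
      | add p q hp hq => simp only [map_add, TensorProduct.add_tmul, hp, hq]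
    have h2 : ∀ t : S.toSubalgebra ⊗[k] S.toSubalgebra,
        Algebra.TensorProduct.map i (Algebra.TensorProduct.map i i)
          (Algebra.TensorProduct.assoc k k k _ _ _
            (Algebra.TensorProduct.map S.comulHom (.id k _) t)) =
        TensorProduct.assoc k B B B
          (Coalgebra.comul.rTensor B (Algebra.TensorProduct.map i i t)) := by
      intro t
      induction t using TensorProduct.induction_on with
      | zero => simp
      | tmul p q =>
        rw [Algebra.TensorProduct.map_tmul, AlgHom.id_apply, h1, map_val_comulHom]
        rfl
      | add p q hp hq => simp only [map_add, hp, hq]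
    have h3 : ∀ t : S.toSubalgebra ⊗[k] S.toSubalgebra,
        Algebra.TensorProduct.map i (Algebra.TensorProduct.map i i)
          (Algebra.TensorProduct.map (.id k _) S.comulHom t) =
        Coalgebra.comul.lTensor B (Algebra.TensorProduct.map i i t) := by
      intro t
      induction t using TensorProduct.induction_on with
      | zero => simp
      | tmul p q =>
        rw [Algebra.TensorProduct.map_tmul, Algebra.TensorProduct.map_tmul, map_val_comulHom]
        rfl
      | add p q hp hq => simp only [map_add, hp, hq]
    refine (h2 (S.comulHom x)).trans (Eq.trans ?_ (h3 (S.comulHom x)).symm)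
    rw [map_val_comulHom]
    exact Coalgebra.coassoc_apply (x : B)
  · refine AlgHom.ext fun x => (Algebra.TensorProduct.lid k S.toSubalgebra).injective
      (Subtype.ext ?_)
    have h : ∀ t : S.toSubalgebra ⊗[k] S.toSubalgebra,
        ((Algebra.TensorProduct.lid k S.toSubalgebra (Algebra.TensorProduct.map
          ((Bialgebra.counitAlgHom k B).comp i) (.id k _) t) : S.toSubalgebra) : B) =
        TensorProduct.lid k B (Coalgebra.counit.rTensor B (Algebra.TensorProduct.map i i t)) := by
      intro t
      induction t using TensorProduct.induction_on with
      | zero => simp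
      | tmul p q => simp [i]
      | add p q hp hq => simp only [map_add, Subalgebra.coe_add, hp, hq]
    refine (h (S.comulHom x)).trans ?_
    rw [map_val_comulHom, Coalgebra.rTensor_counit_comul]
    simp
  · refine AlgHom.ext fun x => (Algebra.TensorProduct.rid k k S.toSubalgebra).injective
      (Subtype.ext ?_)
    have h : ∀ t : S.toSubalgebra ⊗[k] S.toSubalgebra,
        ((Algebra.TensorProduct.rid k k S.toSubalgebra (Algebra.TensorProduct.map
          (.id k _) ((Bialgebra.counitAlgHom k B).comp i) t) : S.toSubalgebra) : B) =
        TensorProduct.rid k B (Coalgebra.counit.lTensor B (Algebra.TensorProduct.map i i t)) := by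
      intro t
      induction t using TensorProduct.induction_on with
      | zero => simp
      | tmul p q => simp [i]
      | add p q hp hq => simp only [map_add, Subalgebra.coe_add, hp, hq]
    refine (h (S.comulHom x)).trans ?_
    rw [map_val_comulHom, Coalgebra.lTensor_counit_comul]
    simp

theorem map_val_comul (x : S.toSubalgebra) :
    Algebra.TensorProduct.map S.toSubalgebra.val S.toSubalgebra.val
      (Coalgebra.comul (R := k) x) = Coalgebra.comul (R := k) (x : B) :=
  S.map_val_comulHom x

theorem counit_coe (x : S.toSubalgebra) :
    Coalgebra.counit (R := k) (x : B) = Coalgebra.counit (R := k) x := rfl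

/-- The restricted antipode. -/
noncomputable def antipodeHom : S.toSubalgebra →ₗ[k] S.toSubalgebra :=
  (HopfAlgebra.antipode k (A := B)).restrict (p := S.toSubalgebra.toSubmodule)
    (q := S.toSubalgebra.toSubmodule) S.antipode_mem

noncomputable instance : HopfAlgebra k S.toSubalgebra := by
  let i := S.toSubalgebra.val
  -- Convolution on the subalgebra is compatible with convolution on `B`, so both antipode
  -- identities are inherited.
  have h (f g : S.toSubalgebra →ₗ[k] S.toSubalgebra) (f' g' : B →ₗ[k] B)
      (hf : ∀ x, (f x : B) = f' x) (hg : ∀ x, (g x : B) = g' x) (x : S.toSubalgebra) :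
      (((toConv f * toConv g : WithConv (S.toSubalgebra →ₗ[k] S.toSubalgebra)) x :
        S.toSubalgebra) : B) = (toConv f' * toConv g' : WithConv (B →ₗ[k] B)) (x : B) := by
    have h' : ∀ t : S.toSubalgebra ⊗[k] S.toSubalgebra,
        ((LinearMap.mul' k _ (TensorProduct.map f g t) : S.toSubalgebra) : B) =
        LinearMap.mul' k B (TensorProduct.map f' g' (Algebra.TensorProduct.map i i t)) := by
      intro t
      induction t using TensorProduct.induction_on with
      | zero => simp
      | tmul p q => simp [i, hf, hg]
      | add p q hp hq => simp only [map_add, Subalgebra.coe_add, hp, hq]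
    refine (h' (Coalgebra.comul x)).trans ?_
    rw [map_val_comul]
    rfl
  refine HopfAlgebra.ofConvInverse S.antipodeHom
    (WithConv.ext (LinearMap.ext fun x => Subtype.ext ?_))
    (WithConv.ext (LinearMap.ext fun x => Subtype.ext ?_))
  · refine (h _ _ (HopfAlgebra.antipode k) LinearMap.id (fun _ => rfl) (fun _ => rfl) x).trans ?_
    rw [LinearMap.antipode_mul_id]
    rfl
  · refine (h _ _ LinearMap.id (HopfAlgebra.antipode k) (fun _ => rfl) (fun _ => rfl) x).trans ?_
    rw [LinearMap.id_mul_antipode]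
    rfl

/-- The inclusion of a Hopf subalgebra. -/
noncomputable def subtype : S.toSubalgebra →ₐc[k] B :=
  .ofAlgHom S.toSubalgebra.val rfl (AlgHom.ext fun x => S.map_val_comul x)

/-- The inclusion of a Hopf subalgebra in a larger one. -/
noncomputable def inclusion {S T : HopfSubalgebra k B} (h : S ≤ T) :
    S.toSubalgebra →ₐc[k] T.toSubalgebra :=
  .ofAlgHom (Subalgebra.inclusion h) rfl <| AlgHom.ext fun x => by
    apply map_val_injective T.toSubalgebra
    refine Eq.trans ?_ (T.map_val_comul _).symm
    refine Eq.trans ?_ (S.map_val_comul x)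
    change Algebra.TensorProduct.map _ _ (Algebra.TensorProduct.map _ _ _) = _
    rw [← AlgHom.comp_apply, ← Algebra.TensorProduct.map_comp]
    rfl

end HopfSubalgebra

end HopfSubalgebras

/-! ### Group functors of directed unions as limits. -/

section Limits

open CategoryTheory Opposite

/-- Restriction of characters along a morphism of Hopf algebras. -/
noncomputable def characterComap {k B B' A : Type*} [CommRing k] [CommRing B] [HopfAlgebra k B]
    [CommRing B'] [HopfAlgebra k B'] [CommRing A] [Algebra k A] (h : B' →ₐc[k] B) :
    WithConv (B →ₐ[k] A) →* WithConv (B' →ₐ[k] A) where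
  toFun φ := toConv (φ.ofConv.comp (h : B' →ₐ[k] B))
  map_one' := WithConv.ext (AlgHom.ext fun x => by simp)
  map_mul' φ ψ := WithConv.ext (AlgHom.convMul_comp_bialgHom_distrib φ ψ h)

variable {k B : Type} [Field k] [CommRing B] [HopfAlgebra k B]

/-- The morphism of group functors induced by a morphism of Hopf algebras. -/
noncomputable def pointsFunctorMap {B' : Type} [CommRing B'] [HopfAlgebra k B'] (h : B' →ₐc[k] B) :
    pointsFunctor.{u} k B ⟶ pointsFunctor.{u} k B' where
  app _ := GrpCat.ofHom (characterComap h)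
  naturality _ _ _ := rfl

/-- The group functors of a set of Hopf subalgebras. -/
noncomputable def subalgebraFunctor (𝒮 : Set (HopfSubalgebra k B)) :
    (𝒮)ᵒᵖ ⥤ CommAlgCat.{u} k ⥤ GrpCat.{u} where
  obj S := pointsFunctor k S.unop.1.toSubalgebra
  map f := pointsFunctorMap (HopfSubalgebra.inclusion (leOfHom f.unop))
  map_id _ := rfl
  map_comp _ _ := rfl

/-- The restriction maps to the members of a set of Hopf subalgebras. -/
noncomputable def subalgebraCone (𝒮 : Set (HopfSubalgebra k B)) :
    (Functor.const _).obj (pointsFunctor.{u} k B) ⟶ subalgebraFunctor.{u} 𝒮 where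
  app S := pointsFunctorMap S.unop.1.subtype
  naturality _ _ _ := rfl

variable {𝒮 : Set (HopfSubalgebra k B)}

theorem character_ext_of_cover (hB : ∀ x : B, ∃ S ∈ 𝒮, x ∈ S.toSubalgebra) {A : Type*}
    [CommRing A] [Algebra k A] {φ ψ : WithConv (B →ₐ[k] A)}
    (h : ∀ S ∈ 𝒮, characterComap S.subtype φ = characterComap S.subtype ψ) : φ = ψ := by
  refine WithConv.ext (AlgHom.ext fun x => ?_)
  obtain ⟨S, hS, hx⟩ := hB x
  exact congrArg (fun χ : WithConv (S.toSubalgebra →ₐ[k] A) => χ.ofConv ⟨x, hx⟩) (h S hS)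

/-- Every element lies in some member of the family, and directedness makes its prescribed value
independent of the member and compatible with sums and products. -/
theorem exists_glue_characters (h𝒮 : DirectedOn (· ≤ ·) 𝒮)
    (hB : ∀ x : B, ∃ S ∈ 𝒮, x ∈ S.toSubalgebra) {A : Type*}
    [CommRing A] [Algebra k A] (f : ∀ S : 𝒮, WithConv (S.1.toSubalgebra →ₐ[k] A))
    (hf : ∀ (S T : 𝒮) (h : S ≤ T),
      characterComap (HopfSubalgebra.inclusion (S := S.1) (T := T.1) h) (f T) = f S) :
    ∃ φ : WithConv (B →ₐ[k] A), ∀ S : 𝒮, characterComap S.1.subtype φ = f S := by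
  have hne : Nonempty 𝒮 := let ⟨S, hS, _⟩ := hB 0; ⟨⟨S, hS⟩⟩
  have htop : (⊤ : Subalgebra k B) ≤ ⨆ S : 𝒮, S.1.toSubalgebra := fun x _ =>
    let ⟨S, hS, hx⟩ := hB x
    le_iSup (fun S : 𝒮 => S.1.toSubalgebra) ⟨S, hS⟩ hx
  have hdir : Directed (· ≤ ·) fun S : 𝒮 => S.1.toSubalgebra := fun S T =>
    let ⟨U, hU, h1, h2⟩ := h𝒮 S.1 S.2 T.1 T.2
    ⟨⟨U, hU⟩, h1, h2⟩
  have hf' (S T : 𝒮) (h : S.1.toSubalgebra ≤ T.1.toSubalgebra) :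
      (f S).ofConv = (f T).ofConv.comp (Subalgebra.inclusion h) :=
    congrArg WithConv.ofConv (hf S T h).symm
  let g := Subalgebra.iSupLift (fun S : 𝒮 => S.1.toSubalgebra) hdir (fun S => (f S).ofConv)
    hf' ⊤ htop
  refine ⟨toConv (g.comp Subalgebra.topEquiv.symm.toAlgHom), fun S => ?_⟩
  refine WithConv.ext (AlgHom.ext fun x => ?_)
  exact Subalgebra.iSupLift_inclusion (K := fun S : 𝒮 => S.1.toSubalgebra) (dir := hdir)
    (f := fun S => (f S).ofConv) (hf := hf') (T := ⊤) (hT := htop) x le_top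

/-- The group functor of a directed union of Hopf subalgebras is the limit of their group
functors. -/
theorem nonempty_isLimit_subalgebraCone (h𝒮 : DirectedOn (· ≤ ·) 𝒮)
    (hB : ∀ x : B, ∃ S ∈ 𝒮, x ∈ S.toSubalgebra) :
    Nonempty (Limits.IsLimit (Limits.Cone.mk _ (subalgebraCone.{u} 𝒮))) := by
  -- The limit property is tested at each algebra `A` separately. Gluing gives the lift, and
  -- `character_ext_of_cover` gives both its multiplicativity and its uniqueness.
  refine ⟨Limits.evaluationJointlyReflectsLimits _ fun A => ?_⟩
  have glue (s : Limits.Cone (subalgebraFunctor.{u} 𝒮 ⋙ (evaluation _ _).obj A)) (p : s.pt) :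
      ∃ φ : WithConv (B →ₐ[k] A), ∀ S : 𝒮,
        characterComap S.1.subtype φ = (s.π.app (op S)).hom p :=
    exists_glue_characters h𝒮 hB (fun S => (s.π.app (op S)).hom p) fun S T h =>
      congrArg (fun q => q.hom p) (s.w (homOfLE h).op)
  choose g hg using glue
  refine
    { lift := fun s => GrpCat.ofHom
        { toFun := g s
          map_one' := character_ext_of_cover hB fun S hS => by
            rw [hg s 1 ⟨S, hS⟩, map_one, map_one]
            rfl
          map_mul' := fun p q => character_ext_of_cover hB fun S hS => by
            rw [hg s _ ⟨S, hS⟩, map_mul, map_mul, hg s _ ⟨S, hS⟩, hg s _ ⟨S, hS⟩]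
            rfl }
      fac := fun s S => GrpCat.hom_ext (MonoidHom.ext fun p => hg s p S.unop)
      uniq := fun s m hm => GrpCat.hom_ext (MonoidHom.ext fun p =>
        character_ext_of_cover hB fun S hS => ?_) }
  exact (congrArg (fun q => q.hom p) (hm (op ⟨S, hS⟩))).trans (hg s p ⟨S, hS⟩).symm

theorem isProUnipotent_pointsFunctor (h𝒮 : DirectedOn (· ≤ ·) 𝒮)
    (hB : ∀ x : B, ∃ S ∈ 𝒮, x ∈ S.toSubalgebra)
    (hU : ∀ S ∈ 𝒮, IsUnipotentAlgebraicGroup (pointsFunctor.{u} k S.toSubalgebra)) :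
    IsProUnipotent (pointsFunctor.{u} k B) := by
  have hne : Nonempty 𝒮 := let ⟨S, hS, _⟩ := hB 0; ⟨⟨S, hS⟩⟩
  have hdir : IsDirectedOrder 𝒮 := ⟨fun S T =>
    let ⟨U, hU, h1, h2⟩ := h𝒮 S.1 S.2 T.1 T.2
    ⟨⟨U, hU⟩, h1, h2⟩⟩
  exact ⟨(𝒮)ᵒᵖ, inferInstance, inferInstance, subalgebraFunctor 𝒮, subalgebraCone 𝒮,
    fun S => hU _ S.unop.2, nonempty_isLimit_subalgebraCone h𝒮 hB⟩

theorem IsProUnipotent.of_iso {G G' : CommAlgCat.{u} k ⥤ GrpCat.{u}} (h : IsProUnipotent G)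
    (e : G' ≅ G) : IsProUnipotent G' := by
  obtain ⟨J, _, hJ, F, π, hF, ⟨hl⟩⟩ := h
  exact ⟨J, _, hJ, F, (Functor.const J).map e.hom ≫ π, hF,
    ⟨hl.ofIsoLimit (Limits.Cone.ext e.symm fun j => by simp)⟩⟩

/-- A Hopf subalgebra generated by the entries of an upper unitriangular comultiplicative matrix
represents a unipotent algebraic group. -/
theorem isUnipotentAlgebraicGroup_of_matrix (S : HopfSubalgebra k B) {n : ℕ}
    (x : Matrix (Fin n) (Fin n) B) (hS : S.toSubalgebra = Algebra.adjoin k {b | ∃ i j, b = x i j})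
    (h1 : ∀ i, x i i = 1) (h0 : ∀ i j, j < i → x i j = 0)
    (hc : ∀ i j, Coalgebra.comul (R := k) (x i j) = ∑ l, x i l ⊗ₜ[k] x l j)
    (he : ∀ i j, Coalgebra.counit (R := k) (x i j) = (1 : Matrix (Fin n) (Fin n) k) i j) :
    IsUnipotentAlgebraicGroup (pointsFunctor.{u} k S.toSubalgebra) := by
  have hmem : ∀ i j, x i j ∈ S.toSubalgebra := fun i j =>
    hS ▸ Algebra.subset_adjoin ⟨i, j, rfl⟩
  refine ⟨S.toSubalgebra, inferInstance, inferInstance, n, fun i j => ⟨x i j, hmem i j⟩,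
    ⟨Iso.refl _⟩, fun i => Subtype.ext (h1 i), fun i j h => Subtype.ext (h0 i j h),
    fun i j => ?_, fun i j => (S.counit_coe _).symm.trans (he i j), ?_⟩
  · apply HopfSubalgebra.map_val_injective S.toSubalgebra
    rw [S.map_val_comul, hc, map_sum]
    rfl
  · have hinj := Subalgebra.map_injective (f := S.toSubalgebra.val) Subtype.val_injective
    apply hinj
    rw [← Algebra.adjoin_image, Algebra.map_top, Subalgebra.range_val]
    refine Eq.trans ?_ hS.symm
    congr 1
    ext b
    constructor
    · rintro ⟨_, ⟨i, j, rfl⟩, rfl⟩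
      exact ⟨i, j, rfl⟩
    · rintro ⟨i, j, rfl⟩
      exact ⟨_, ⟨i, j, rfl⟩, rfl⟩

end Limits

open CategoryTheory

/-! ### Factor matrices of words and pro-unipotence. -/

section FactorSubalgebras

/-- The upper unitriangular matrix of the classes of the factors of the word `w`. -/
noncomputable def factorMatrix (w : List ℤ) : Matrix (Fin (w.length + 1)) (Fin (w.length + 1))
    (QuasiShuffle ⧸ nonsingularIdeal) :=
  fun i j => if i ≤ j then Ideal.Quotient.mk nonsingularIdeal (word ((w.take j).drop i)) else 0

theorem factorMatrix_of_le {w : List ℤ} {i j : Fin (w.length + 1)} (h : i ≤ j) :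
    factorMatrix w i j = Ideal.Quotient.mk nonsingularIdeal (word ((w.take j).drop i)) := if_pos h

theorem factorMatrix_of_lt {w : List ℤ} {i j : Fin (w.length + 1)} (h : j < i) :
    factorMatrix w i j = 0 := if_neg (not_le.2 h)

theorem factorMatrix_self (w : List ℤ) (i : Fin (w.length + 1)) : factorMatrix w i i = 1 := by
  rw [factorMatrix_of_le le_rfl, List.drop_eq_nil_of_le (by rw [List.length_take]; omega),
    ← one_def, map_one]

theorem comul_mk_word (v : List ℤ) :
    Coalgebra.comul (R := ℚ) (Ideal.Quotient.mk nonsingularIdeal (word v)) =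
      ∑ i ∈ Finset.range (v.length + 1), Ideal.Quotient.mk nonsingularIdeal (word (v.take i)) ⊗ₜ[ℚ]
        Ideal.Quotient.mk nonsingularIdeal (word (v.drop i)) := by
  rw [Bialgebra.Quotient.comul_mk, comul_word, map_sum]
  rfl

/-- Cutting the factor between positions i and j at an intermediate position l yields the factors
from i to l and from l to j. Positions l outside this range contribute zero by triangularity. -/
theorem comul_factorMatrix (w : List ℤ) (i j : Fin (w.length + 1)) :
    Coalgebra.comul (R := ℚ) (factorMatrix w i j) =
      ∑ l, factorMatrix w i l ⊗ₜ[ℚ] factorMatrix w l j := by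
  rcases lt_or_ge j i with h | h
  · rw [factorMatrix_of_lt h, map_zero]
    refine (Finset.sum_eq_zero fun l _ => ?_).symm
    rcases lt_or_ge l i with h' | h'
    · rw [factorMatrix_of_lt h', TensorProduct.zero_tmul]
    · rw [factorMatrix_of_lt (lt_of_lt_of_le h h'), TensorProduct.tmul_zero]
  · have hij : (i : ℕ) ≤ j := h
    have hj : (j : ℕ) < w.length + 1 := j.2
    have hlen : ((w.take j).drop i).length = j - i := by
      rw [List.length_drop, List.length_take]; omega
    rw [factorMatrix_of_le h, comul_mk_word, hlen]
    refine Finset.sum_bij_ne_zero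
      (fun a ha _ => (⟨i + a, by rw [Finset.mem_range] at ha; omega⟩ : Fin (w.length + 1)))
      (fun _ _ _ => Finset.mem_univ _) (fun a _ _ b _ _ hab => by simpa using hab) ?_ ?_
    · intro l _ hl
      have hil : i ≤ l := by
        by_contra hh
        exact hl (by rw [factorMatrix_of_lt (not_le.1 hh), TensorProduct.zero_tmul])
      have hlj : l ≤ j := by
        by_contra hh
        exact hl (by rw [factorMatrix_of_lt (not_le.1 hh), TensorProduct.tmul_zero])
      have hil' : (i : ℕ) ≤ l := hil
      have hlj' : (l : ℕ) ≤ j := hlj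
      rw [factorMatrix_of_le hil, factorMatrix_of_le hlj] at hl
      refine ⟨l - i, by rw [Finset.mem_range]; omega, ?_, Fin.ext (by simp; omega)⟩
      rwa [List.take_drop, List.drop_drop, List.take_take, Nat.add_sub_cancel' hil',
        min_eq_left hlj']
    · intro a ha _
      rw [Finset.mem_range] at ha
      rw [factorMatrix_of_le (Fin.le_def.2 (by simp)), factorMatrix_of_le (Fin.le_def.2 (by
        simp only; omega)), List.take_drop, List.drop_drop, List.take_take,
        min_eq_left (by omega)]

theorem counit_factorMatrix (w : List ℤ) (i j : Fin (w.length + 1)) :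
    Coalgebra.counit (R := ℚ) (factorMatrix w i j) =
      (1 : Matrix (Fin (w.length + 1)) (Fin (w.length + 1)) ℚ) i j := by
  rw [Matrix.one_apply]
  rcases lt_trichotomy i j with h | rfl | h
  · have h' : (i : ℕ) < j := h
    rw [factorMatrix_of_le h.le, if_neg h.ne, Bialgebra.Quotient.counit_mk, counit_word, if_neg]
    intro h0
    have := congrArg List.length h0
    rw [List.length_drop, List.length_take, List.length_nil] at this
    omega
  · rw [factorMatrix_self, if_pos rfl, Bialgebra.counit_one]
  · rw [factorMatrix_of_lt h, if_neg h.ne', map_zero]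

/-- The subalgebra of `H ⧸ 𝒩` generated by the factors of the word `w`. -/
noncomputable def factorAdjoin (w : List ℤ) : Subalgebra ℚ (QuasiShuffle ⧸ nonsingularIdeal) :=
  Algebra.adjoin ℚ {b | ∃ i j, b = factorMatrix w i j}

theorem mk_word_mem_factorAdjoin {v w : List ℤ} (h : v <:+: w) :
    Ideal.Quotient.mk nonsingularIdeal (word v) ∈ factorAdjoin w := by
  obtain ⟨s, t, rfl⟩ := h
  refine Algebra.subset_adjoin ⟨⟨s.length, by simp⟩,
    ⟨s.length + v.length, by simp⟩, ?_⟩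
  rw [factorMatrix_of_le (Fin.le_def.2 (by simp))]
  congr 2
  simp only
  rw [← List.length_append, List.take_left, List.drop_left]

theorem factorAdjoin_le {w : List ℤ} {S : Subalgebra ℚ (QuasiShuffle ⧸ nonsingularIdeal)}
    (h : ∀ v, v <:+: w → Ideal.Quotient.mk nonsingularIdeal (word v) ∈ S) :
    factorAdjoin w ≤ S := by
  refine Algebra.adjoin_le ?_
  rintro _ ⟨i, j, rfl⟩
  rcases lt_or_ge j i with hij | hij
  · rw [factorMatrix_of_lt hij]; exact zero_mem S
  · rw [factorMatrix_of_le hij]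
    exact h _ ((List.drop_suffix _ _).isInfix.trans (List.take_prefix _ _).isInfix)

/-- The antipode recursion multiplies a prefix of `v` by the antipode of a strictly shorter suffix;
both remain factors of `w`. -/
theorem mk_antipode_word_mem_factorAdjoin {v w : List ℤ} (h : v <:+: w) :
    Ideal.Quotient.mk nonsingularIdeal (antipodeWord v) ∈ factorAdjoin w := by
  generalize hn : v.length = n
  induction n using Nat.strong_induction_on generalizing v with
  | _ n ih =>
    rw [antipodeWord]
    split_ifs with h0
    · rw [map_one]; exact one_mem _
    · rw [map_neg, map_sum]
      refine neg_mem (sum_mem fun i _ => ?_)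
      rw [map_mul]
      refine mul_mem (mk_word_mem_factorAdjoin ((List.take_prefix _ _).isInfix.trans h))
        (ih _ ?_ ((List.drop_suffix _ _).isInfix.trans h) rfl)
      have := i.2
      rw [List.length_drop]
      omega

/-- The Hopf subalgebra of `H ⧸ 𝒩` generated by the factors of the word `w`. -/
noncomputable def factorSubalgebra (w : List ℤ) :
    HopfSubalgebra ℚ (QuasiShuffle ⧸ nonsingularIdeal) where
  toSubalgebra := factorAdjoin w
  comul_mem := by
    let R := (Algebra.TensorProduct.map (factorAdjoin w).val (factorAdjoin w).val).range
    suffices h : factorAdjoin w ≤ R.comap (Bialgebra.comulAlgHom ℚ _) from h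
    refine factorAdjoin_le fun v hv => ?_
    change Coalgebra.comul (R := ℚ) (Ideal.Quotient.mk nonsingularIdeal (word v)) ∈ R
    rw [comul_mk_word]
    exact sum_mem fun i _ =>
      ⟨⟨_, mk_word_mem_factorAdjoin ((List.take_prefix i v).isInfix.trans hv)⟩ ⊗ₜ
        ⟨_, mk_word_mem_factorAdjoin ((List.drop_suffix i v).isInfix.trans hv)⟩, rfl⟩
  antipode_mem := by
    suffices h : factorAdjoin w ≤ (factorAdjoin w).comap (HopfAlgebra.antipodeAlgHom ℚ _) from h
    refine factorAdjoin_le fun v hv => ?_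
    change HopfAlgebra.antipode ℚ (Ideal.Quotient.mk nonsingularIdeal (word v)) ∈ factorAdjoin w
    rw [HopfAlgebra.Quotient.antipode_mk]
    exact antipodeMap_word v ▸ mk_antipode_word_mem_factorAdjoin hv

theorem factorSubalgebra_le_of_isInfix {v w : List ℤ} (h : v <:+: w) :
    factorSubalgebra v ≤ factorSubalgebra w :=
  factorAdjoin_le fun _ hu => mk_word_mem_factorAdjoin (hu.trans h)

/-- The concatenation of two words has both as factors, hence also all of their factors. -/
theorem directedOn_range_factorSubalgebra :
    DirectedOn (· ≤ ·) (Set.range factorSubalgebra) := by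
  rintro _ ⟨v, rfl⟩ _ ⟨w, rfl⟩
  exact ⟨_, ⟨v ++ w, rfl⟩, factorSubalgebra_le_of_isInfix (List.prefix_append v w).isInfix,
    factorSubalgebra_le_of_isInfix (List.suffix_append v w).isInfix⟩

theorem exists_mem_factorSubalgebra (x : QuasiShuffle ⧸ nonsingularIdeal) :
    ∃ S ∈ Set.range factorSubalgebra, x ∈ S.toSubalgebra := by
  obtain ⟨x, rfl⟩ := Ideal.Quotient.mk_surjective x
  induction x using word_induction with
  | h0 => exact ⟨_, ⟨[], rfl⟩, zero_mem _⟩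
  | hadd x y hx hy =>
    obtain ⟨S, hS, hx⟩ := hx
    obtain ⟨T, hT, hy⟩ := hy
    obtain ⟨U, hU, hSU, hTU⟩ := directedOn_range_factorSubalgebra S hS T hT
    exact ⟨U, hU, add_mem (hSU hx) (hTU hy)⟩
  | hsmul c x hx =>
    obtain ⟨S, hS, hx⟩ := hx
    exact ⟨S, hS, S.toSubalgebra.smul_mem hx c⟩
  | hw w => exact ⟨_, ⟨w, rfl⟩, mk_word_mem_factorAdjoin List.infix_rfl⟩

theorem isProUnipotent_pointsFunctor_quotient :
    IsProUnipotent (pointsFunctor.{u} ℚ (QuasiShuffle ⧸ nonsingularIdeal)) := by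
  refine isProUnipotent_pointsFunctor directedOn_range_factorSubalgebra
    exists_mem_factorSubalgebra ?_
  rintro _ ⟨w, rfl⟩
  exact isUnipotentAlgebraicGroup_of_matrix _ (factorMatrix w) rfl (factorMatrix_self w)
    (fun _ _ h => factorMatrix_of_lt h) (comul_factorMatrix w) (counit_factorMatrix w)

/-- The renormalisation functor is represented by `H ⧸ 𝒩`. -/
noncomputable def renormalisationFunctorIso :
    renormalisationFunctor.{u} ≅ pointsFunctor.{u} ℚ (QuasiShuffle ⧸ nonsingularIdeal) :=
  NatIso.ofComponents (fun A => (renormalisationGroupEquiv A).toGrpIso) fun _ =>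
    GrpCat.hom_ext (MonoidHom.ext fun _ =>
      WithConv.ext (Ideal.Quotient.algHom_ext ℚ (AlgHom.ext fun _ => rfl)))

end FactorSubalgebras

end RenormMZV

theorem mainTheorem2 :
    RenormMZV.IsProUnipotent RenormMZV.renormalisationFunctor.{u} ∧
    ∀ (A : Type u) [CommRing A] [Algebra ℚ A],
      ∃ Φ : RenormMZV.renormalisationGroup A ≃*
          WithConv ((RenormMZV.QuasiShuffle ⧸ RenormMZV.nonsingularIdeal) →ₐ[ℚ] A),
        (∀ (ψ : RenormMZV.renormalisationGroup A) (x : RenormMZV.QuasiShuffle),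
          (Φ ψ).ofConv (Ideal.Quotient.mk RenormMZV.nonsingularIdeal x) = ψ.1.ofConv x) ∧
        Function.Bijective fun ψ : RenormMZV.renormalisationGroup A =>
          ((Φ ψ).ofConv.toLinearMap.domRestrict RenormMZV.generatorSpace :
            RenormMZV.generatorSpace →ₗ[ℚ] A) :=
  ⟨RenormMZV.isProUnipotent_pointsFunctor_quotient.of_iso RenormMZV.renormalisationFunctorIso,
    fun A _ _ => ⟨RenormMZV.renormalisationGroupEquiv A, RenormMZV.renormalisationGroupEquiv_mk,
      RenormMZV.bijective_domRestrict_generatorSpace A⟩⟩
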